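/- A \emph{single-source multicast problem} $\mathbf N$ consists of a finite acyclic directed graph $G=(V,E)$ (the elements of $E$ are called channels; parallel channels are allowed), a source node $s\in V$, a set $T\subseteq V\setminus\{s\}$ of sink nodes, and an information rate $w\ge 1$ with $w\le C_t$ for all $t\in T$, where $C_t$ is the minimum cut capacity between $s$ and $t$. Let $J=V\setminus(\{s\}\cup T)$ be the set of internal nodes. For a finite field $\mathcal F$, random linear network coding is defined as follows. In addition to the channels in $E$, $w$ imaginary channels $d_1,\dots,d_w$ enter $s$, and $f_{d_j}\in\mathcal F^w$ is the $j$-th standard basis vector; every channel $e\in E$ has the global encoding kernel $f_e=\sum_d k_{d,e}f_d\in\mathcal F^w$, where $d$ runs over the channels (including the imaginary ones) that enter the tail of $e$, and the coefficients $k_{d,e}$ are independent and uniformly distributed on $\mathcal F$. For $t\in T$ let $F_t$ be the matrix whose columns are the vectors $f_e$ for the channels $e\in E$ that enter $t$. The failure probability is $P_e=\Pr(\exists\, t\in T:\ \operatorname{rank}F_t<w)$, and $$\Omega(\mathbf N)=\limsup_{|\mathcal F|\to\infty}|\mathcal F|\cdot P_e .$$ Let $l\ge 1$. (a) Let $n\ge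 0$, and let $\mathcal M^*_{n,l}$ be the set of all problems $\mathbf N$ (with any rate $w$) with $|T|=l$ for which one can choose, for each sink $t\in T$, $w$ pairwise channel-disjoint paths from $s$ to $t$ such that $\sum_{t\in T}r_t\le n$, where $r_t$ is the number of internal nodes lying on at least one of the $w$ paths chosen for $t$. Then $$\max_{\mathbf N\in\mathcal M^*_{n,l}}\Omega(\mathbf N)=l+n .$$ (b) Let $m\ge 0$, and let $\mathcal N^*_{m,l}$ be the set of all problems $\mathbf N$ (with any rate $w$) with $|T|=l$ and $|J|=m$. Then $$\max_{\mathbf N\in\mathcal N^*_{m,l}}\Omega(\mathbf N)=l(1+m) .$$ Both maxima are attained. -/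

import Mathlib

namespace RLNC

/-- A communication network: a finite acyclic directed graph in which several channels between the
same two nodes are allowed. -/
structure Network where
  /-- the nodes -/
  V : Type
  /-- the channels -/
  E : Type
  [fintypeV : Fintype V]
  [fintypeE : Fintype E]
  tail : E → V
  head : E → V
  acyclic : ∀ v : V, ¬ Relation.TransGen (fun u u' => ∃ e, tail e = u ∧ head e = u') v v

attribute [instance] Network.fintypeV Network.fintypeE

namespace Network

variable (G : Network)

/-- The capacity of a minimum cut between `u` and `v`: the least number of channels that lead from
`A` to its complement, over all sets `A` of nodes that contain `u` but not `v`. -/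
noncomputable def minCut (u v : G.V) : ℕ :=
  sInf {c : ℕ | ∃ A : Set G.V, u ∈ A ∧ v ∉ A ∧
    c = Nat.card {e : G.E // G.tail e ∈ A ∧ G.head e ∉ A}}

/-- The list of channels `p` is a directed path from `u` to `v` (with at least one channel). -/
def IsPath (p : List G.E) (u v : G.V) : Prop :=
  p.IsChain (fun d e => G.head d = G.tail e) ∧
    p.head?.map G.tail = some u ∧ p.getLast?.map G.head = some v

/-- In an acyclic network, "`d` enters the node that `e` leaves" is a well-founded relation. -/
theorem wellFounded_adj : WellFounded (fun d e : G.E => G.head d = G.tail e) := by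
  let r : G.E → G.E → Prop := fun d e => G.head d = G.tail e
  have key : ∀ d e, Relation.TransGen r d e →
      Relation.TransGen (fun u u' => ∃ e, G.tail e = u ∧ G.head e = u') (G.tail d) (G.tail e) := by
    intro d e h
    induction h with
    | single h => exact .single ⟨d, rfl, h⟩
    | @tail b c _ h ih => exact ih.tail ⟨b, rfl, h⟩
  have : Std.Irrefl (Relation.TransGen r) := ⟨fun e h => G.acyclic _ (key e e h)⟩
  have wf : WellFounded (Relation.TransGen r) := Finite.wellFounded_of_trans_of_irrefl _
  exact Subrelation.wf (r := Relation.TransGen r) (fun {_ _} h => Relation.TransGen.single (r := r) h) wf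

end Network

/-- A single-source multicast linear network coding problem: a network, its source node `s`, the
set `T` of its sink nodes, and an information rate `w` that does not exceed the minimum cut
capacity between `s` and any sink node. -/
structure Problem extends Network where
  s : V
  T : Finset V
  w : ℕ
  source_notMem : s ∉ T
  rate_pos : 1 ≤ w
  rate_le : ∀ t ∈ T, w ≤ toNetwork.minCut s t

namespace Problem

variable (N : Problem)

/-- The set `J` of the internal nodes, which are neither the source nor a sink. -/
def internalNodes : Set N.V := {v | v ≠ N.s ∧ v ∉ N.T}

/-- The node entered by a channel of the network (`Sum.inl e`) or by one of the `w` imaginary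
channels (`Sum.inr j`), which carry the source symbols into the source node. -/
def entersAt : N.E ⊕ Fin N.w → N.V := Sum.elim N.head (fun _ => N.s)

/-- The adjacent pairs of channels `(d, e)`: `d`, possibly imaginary, enters the node that `e`
leaves. -/
abbrev AdjPair : Type := {p : (N.E ⊕ Fin N.w) × N.E // N.entersAt p.1 = N.tail p.2}

/-- A choice of the local encoding coefficients `k d e` over `F`. -/
abbrev Coeffs (F : Type) : Type := N.AdjPair → F

open scoped Classical in
/-- The global encoding kernel of the channel `e`: the sum, over all channels `d` into the tail
of `e`, of `k d e` times the kernel of `d`; the `j`-th imaginary channel has as its kernel the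
`j`-th standard basis vector. -/
noncomputable def kernel {F : Type} [Field F] (k : N.Coeffs F) : N.E → Fin N.w → F :=
  N.wellFounded_adj.fix fun e rec =>
    ∑ d : {d : N.E ⊕ Fin N.w // N.entersAt d = N.tail e},
      k ⟨(d.1, e), d.2⟩ •
        (match d with
          | ⟨Sum.inl d', h⟩ => rec d' h
          | ⟨Sum.inr j, _⟩ => Pi.single j 1)

open scoped Classical in
theorem kernel_eq {F : Type} [Field F] (k : N.Coeffs F) (e : N.E) :
    N.kernel k e = ∑ d : {d : N.E ⊕ Fin N.w // N.entersAt d = N.tail e},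
      k ⟨(d.1, e), d.2⟩ • Sum.elim (N.kernel k) (fun j => Pi.single j 1) d.1 := by
  rw [kernel, WellFounded.fix_eq]
  refine Finset.sum_congr rfl fun d _ => ?_
  obtain ⟨d | j, h⟩ := d <;> rfl

/-- The decoding matrix of the node `t`, with the kernels of the channels into `t` as columns. -/
noncomputable def decodingMatrix {F : Type} [Field F] (k : N.Coeffs F) (t : N.V) :
    Matrix (Fin N.w) {e : N.E // N.head e = t} F :=
  Matrix.of fun i e => N.kernel k e.1 i

open scoped Classical in
/-- The failure probability `P_e` of random linear network coding over the finite field `F`: all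
local encoding coefficients are independent and uniform on `F`, that is, their vector is uniform on
the finite set `N.Coeffs F`, and failure means that some sink node cannot decode. -/
noncomputable def failureProb (F : Type) [Field F] [Finite F] : ℝ :=
  (Nat.card {k : N.Coeffs F // ∃ t ∈ N.T, (N.decodingMatrix k t).rank < N.w} : ℝ) /
    (Nat.card (N.Coeffs F) : ℝ)

/-- `P` consists of `w` pairwise channel disjoint paths from the source to `t`. -/
def IsDisjointPaths (t : N.V) (P : Fin N.w → List N.E) : Prop :=
  (∀ j, N.IsPath (P j) N.s t) ∧ Pairwise fun i j => List.Disjoint (P i) (P j)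

/-- The number of the internal nodes that lie on the paths of the family `P`. -/
noncomputable def internalCount (P : Fin N.w → List N.E) : ℕ :=
  Set.ncard {v | v ∈ N.internalNodes ∧ ∃ j, ∃ e ∈ P j, N.tail e = v ∨ N.head e = v}

end Problem

/-- A finite field. -/
structure FinField : Type 1 where
  carrier : Type
  [field : Field carrier]
  [finite : Finite carrier]

attribute [instance] FinField.field FinField.finite

/-- The number of elements of a finite field. -/
noncomputable def FinField.card (F : FinField) : ℕ := Nat.card F.carrier

/-- `Ω(N) = limsup |F| · P_e` as `F` runs through the finite fields and `|F| → ∞`; the upper limit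
is taken in the extended reals. -/
noncomputable def Problem.Omega (N : Problem) : EReal :=
  Filter.limsup (fun F : FinField => (((F.card : ℝ) * N.failureProb F.carrier : ℝ) : EReal))
    (Filter.comap FinField.card Filter.atTop)

/-- The problems with `l` sinks such that, for suitable families of `w` channel disjoint paths from
the source to each sink, the numbers of internal nodes of these families sum to at most `n`. -/
def pathBounded (n l : ℕ) : Set Problem :=
  {N | N.T.card = l ∧ ∃ P : N.V → Fin N.w → List N.E,
    (∀ t ∈ N.T, N.IsDisjointPaths t (P t)) ∧ ∑ t ∈ N.T, N.internalCount (P t) ≤ n}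

/-- The problems with `m` internal nodes and `l` sinks. -/
def internalFixed (m l : ℕ) : Set Problem :=
  {N | N.internalNodes.ncard = m ∧ N.T.card = l}

end RLNC

/-! Write q for the size of the field.

Upper bound. For each sink `t` fix a flow of `w` channels into `t` that may start at the source or
at any other sink: a sink that can decode receives a spanning set of kernels and so acts like the
source. Go through the channels in topological order. A channel `e` of the flow is harmless unless
its kernel falls into the span of `cur`, the earlier flow channels that reach beyond the tail of
`e`. Given the past, the kernel of `e` is uniform on the span of the kernels entering its tail. Flow
conservation shows that adjoining this span to the span of `cur` raises the dimension by at least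
`remaining`, the number of flow channels not before `e` that leave the same node, where all origins
of the flow count as one node. So `e` is the first dependent channel with probability at most
q^(-`remaining`). This has order 1/q only for the last channel of each class, and there are at most
1 + (number of internal nodes left by the flow) classes. Any failure produces such a first dependent
channel in the flow of the first failing sink, so a union bound gives Ω ≤ ∑ over `t` of (1 +
internal nodes of the flow). A flow carved out of the given paths leads to `l + n`; an arbitrary
flow leads to `l * (1 + m)`.

Lower bound. In `ladderProblem` the source feeds a chain of `m` internal nodes whose incoming
dimension drops by at least one at each step, and a sink in `D` takes one channel from every node of
the chain. Looking at the channels of a sink from the far end of the chain backwards, each new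
kernel is confined to a space in which the later ones already span codimension at most one, so it is
dependent with probability at least 1/q. A sink in `D` gives `m + 1` such tests, any other sink
gives one. The success probability is at most (1 - 1/q)^M for M tests in total, hence Ω ≥ M. One
sink in `D` settles (a), all sinks in `D` settle (b). -/

namespace RLNC

open scoped Classical
open Filter Topology

/-! ### Integral flows from minimal cut-covering channel sets. -/

section Flow

variable {V E : Type} (tail head : E → V)

/-- The number of channels of `S` that lead from `A` to its complement. -/
noncomputable def cutSize (S : Finset E) (A : Set V) : ℕ :=
  (S.filter fun e => tail e ∈ A ∧ head e ∉ A).card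

/-- Submodularity of cuts, checked channel by channel. The slack term counts channels from `B \ A`
to `A \ B`; equality of cut sizes will force it to vanish. -/
theorem cutSize_inter_add_union (S : Finset E) (A B : Set V) :
    cutSize tail head S (A ∩ B) + cutSize tail head S (A ∪ B) +
      (S.filter fun e => (tail e ∈ B ∧ tail e ∉ A) ∧ head e ∈ A ∧ head e ∉ B).card ≤
    cutSize tail head S A + cutSize tail head S B := by
  simp only [cutSize, Finset.card_filter, ← Finset.sum_add_distrib]
  refine Finset.sum_le_sum fun e _ => ?_
  by_cases h1 : tail e ∈ A <;> by_cases h2 : tail e ∈ B <;> by_cases h3 : head e ∈ A <;>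
    by_cases h4 : head e ∈ B <;> simp [h1, h2, h3, h4]

theorem cutSize_insert_add (S : Finset E) (B : Set V) (v : V) (hv : v ∉ B)
    (hin : ∀ e ∈ S, head e = v → tail e ∈ B) (hout : ∀ e ∈ S, tail e = v → head e ∉ B) :
    cutSize tail head S (insert v B) + (S.filter fun e => head e = v).card =
      cutSize tail head S B + (S.filter fun e => tail e = v).card := by
  simp only [cutSize, Finset.card_filter, ← Finset.sum_add_distrib]
  refine Finset.sum_congr rfl fun e he => ?_
  have h1 := hin e he
  have h2 := hout e he
  by_cases h3 : head e = v <;> by_cases h4 : tail e = v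
  · exact absurd (h4 ▸ h1 h3) hv
  · simp [h3, h4, h1 h3, hv]
  · simp [h3, h4, h2 h4, hv]
  · simp [h3, h4]

/-- An integral form of the max-flow min-cut theorem: if every cut between `Z` and `t` contains at
least `w` channels of `S₀`, then some channels of `S₀` form a flow of value `w` from `Z` to `t`. -/
theorem exists_flow [Finite V] (Z : Set V) (t : V) (ht : t ∉ Z) (S₀ : Finset E) (w : ℕ)
    (hcut : ∀ A : Set V, Z ⊆ A → t ∉ A → w ≤ cutSize tail head S₀ A) :
    ∃ S ⊆ S₀, (∀ v ∉ Z, v ≠ t →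
        (S.filter fun e => head e = v).card = (S.filter fun e => tail e = v).card) ∧
      (∀ e ∈ S, head e ∉ Z) ∧ (∀ e ∈ S, tail e ≠ t) ∧
      (S.filter fun e => head e = t).card = w := by
  -- An inclusion-minimal set that still meets every cut in `w` channels turns out to be the flow.
  obtain ⟨S, hS, hmin⟩ := exists_minimal_le_of_wellFoundedLT
    (fun S : Finset E => ∀ A : Set V, Z ⊆ A → t ∉ A → w ≤ cutSize tail head S A) S₀ hcut
  have hfeas := hmin.prop
  let tight : Set V → Prop := fun A => Z ⊆ A ∧ t ∉ A ∧ cutSize tail head S A = w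
  -- Removing `e` must break some cut condition, and the broken cut was tight and crossed by `e`.
  have hedge : ∀ e ∈ S, ∃ A, tight A ∧ tail e ∈ A ∧ head e ∉ A := by
    intro e he
    have h1 : ¬ ∀ A : Set V, Z ⊆ A → t ∉ A → w ≤ cutSize tail head (S.erase e) A := fun h =>
      Finset.notMem_erase e S (hmin.le_of_le h (Finset.erase_subset e S) he)
    push Not at h1
    obtain ⟨A, hZ, htA, hlt⟩ := h1
    have h2 := hfeas A hZ htA
    have h3 : cutSize tail head (S.erase e) A =
        ((S.filter fun e => tail e ∈ A ∧ head e ∉ A).erase e).card := by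
      rw [cutSize, Finset.filter_erase]
    have hmem : e ∈ S.filter fun e => tail e ∈ A ∧ head e ∉ A := by
      by_contra hne
      rw [Finset.erase_eq_of_notMem hne] at h3
      exact absurd hlt (by rw [h3]; exact not_lt.2 h2)
    rw [Finset.card_erase_of_mem hmem] at h3
    refine ⟨A, ⟨hZ, htA, ?_⟩, (Finset.mem_filter.1 hmem).2⟩
    change _ ≤ cutSize tail head S A at h2
    change _ = cutSize tail head S A - 1 at h3
    omega
  -- Uncrossing: both `A ∩ B` and `A ∪ B` have cut size at least `w`, so submodularity holds with
  -- equality and without slack.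
  have huncross : ∀ A B, tight A → tight B → tight (A ∩ B) ∧ tight (A ∪ B) ∧
      ∀ e ∈ S, tail e ∈ B → tail e ∉ A → head e ∈ A → head e ∈ B := by
    rintro A B ⟨hA1, hA2, hA3⟩ ⟨hB1, hB2, hB3⟩
    have h1 := hfeas (A ∩ B) (Set.subset_inter hA1 hB1) fun h => hA2 h.1
    have h2 := hfeas (A ∪ B) (hA1.trans Set.subset_union_left) fun h => h.elim hA2 hB2
    have h3 := cutSize_inter_add_union tail head S A B
    refine ⟨⟨Set.subset_inter hA1 hB1, fun h => hA2 h.1, by omega⟩,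
      ⟨hA1.trans Set.subset_union_left, fun h => h.elim hA2 hB2, by omega⟩, ?_⟩
    intro e he a b c
    by_contra d
    have : 0 < (S.filter fun e => (tail e ∈ B ∧ tail e ∉ A) ∧ head e ∈ A ∧ head e ∉ B).card :=
      Finset.card_pos.2 ⟨e, by simp [he, a, b, c, d]⟩
    omega
  -- A channel entering a tight set would go backwards relative to a tight set that it leaves, which
  -- uncrossing excludes.
  have hback : ∀ A, tight A → ∀ e ∈ S, head e ∈ A → tail e ∈ A := by
    intro A hA e he h1
    by_contra h2
    obtain ⟨B, hB, h3, h4⟩ := hedge e he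
    exact h4 ((huncross A B hA hB).2.2 e he h3 h2 h1)
  -- A maximal tight set avoiding `v` absorbs, by unions, the tails of all channels into `v`.
  -- Dually, a minimal tight set containing `v` avoids the heads of all channels out of `v`.
  have hmax : ∀ v, (∃ e ∈ S, head e = v) →
      ∃ B, tight B ∧ v ∉ B ∧ ∀ e ∈ S, head e = v → tail e ∈ B := by
    rintro v ⟨e₀, he₀, rfl⟩
    obtain ⟨A₀, hA₀, -, h0⟩ := hedge e₀ he₀
    obtain ⟨B, -, hB⟩ := exists_maximal_ge_of_wellFoundedGT
      (fun B : Set V => tight B ∧ head e₀ ∉ B) A₀ ⟨hA₀, h0⟩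
    refine ⟨B, hB.prop.1, hB.prop.2, fun e he hev => ?_⟩
    obtain ⟨A, hA, h1, h2⟩ := hedge e he
    exact hB.le_of_ge (y := A ∪ B) ⟨(huncross A B hA hB.prop.1).2.1,
      fun h => h.elim (hev ▸ h2) hB.prop.2⟩ Set.subset_union_right (Or.inl h1)
  have hminl : ∀ v, (∃ e ∈ S, tail e = v) →
      ∃ A, tight A ∧ v ∈ A ∧ ∀ e ∈ S, tail e = v → head e ∉ A := by
    rintro v ⟨e₀, he₀, rfl⟩
    obtain ⟨A₀, hA₀, h0, -⟩ := hedge e₀ he₀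
    obtain ⟨B, -, hB⟩ := exists_minimal_le_of_wellFoundedLT
      (fun B : Set V => tight B ∧ tail e₀ ∈ B) A₀ ⟨hA₀, h0⟩
    refine ⟨B, hB.prop.1, hB.prop.2, fun e he hev hcon => ?_⟩
    obtain ⟨A, hA, h1, h2⟩ := hedge e he
    exact h2 (hB.le_of_le (y := A ∩ B) ⟨(huncross A B hA hB.prop.1).1, hev ▸ h1, hB.prop.2⟩
      Set.inter_subset_right hcon).1
  refine ⟨S, hS, fun v hvZ hvt => ?_, fun e he h => ?_, fun e he h => ?_, le_antisymm ?_ ?_⟩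
  -- Adding `v` to the maximal tight set cannot push the cut below `w`, so inflow is at most
  -- outflow; removing `v` from the minimal one gives the reverse.
  · have hle : (S.filter fun e => head e = v).card ≤ (S.filter fun e => tail e = v).card := by
      by_cases h : ∃ e ∈ S, head e = v
      · obtain ⟨B, hB, hv, hin⟩ := hmax v h
        have h1 := cutSize_insert_add tail head S B v hv hin
          fun e he hev hcon => hv (hev ▸ hback B hB e he hcon)
        have h2 := hfeas (insert v B) (hB.1.trans (Set.subset_insert _ _))
          (by simp [hB.2.1, hvt.symm])
        have h3 := hB.2.2
        omega
      · push Not at h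
        rw [Finset.filter_false_of_mem h]
        simp
    refine hle.antisymm ?_
    by_cases h : ∃ e ∈ S, tail e = v
    · obtain ⟨A, hA, hv, hout⟩ := hminl v h
      have hins : insert v (A \ {v}) = A := by simp [Set.insert_eq_of_mem hv]
      have hne : ∀ e ∈ S, tail e = v → head e ≠ v := fun e he h1 h2 => hout e he h1 (h2 ▸ hv)
      have h1 := cutSize_insert_add tail head S (A \ {v}) v (by simp)
        (fun e he hev => ⟨hback A hA e he (hev ▸ hv), fun h => hne e he h hev⟩)
        fun e he hev hcon => hout e he hev hcon.1
      have h2 := hfeas (A \ {v}) (fun x hx => ⟨hA.1 hx, fun h => hvZ (h ▸ hx)⟩)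
        fun h => hA.2.1 h.1
      have h3 := hA.2.2
      rw [hins] at h1
      omega
    · push Not at h
      rw [Finset.filter_false_of_mem h]
      simp
  · obtain ⟨A, hA, -, h1⟩ := hedge e he
    exact h1 (hA.1 h)
  · obtain ⟨A, hA, h1, -⟩ := hedge e he
    exact hA.2.1 (h ▸ h1)
  · by_cases h : ∃ e ∈ S, head e = t
    · obtain ⟨B, hB, hv, hin⟩ := hmax t h
      rw [← hB.2.2]
      refine Finset.card_le_card fun e he => ?_
      simp only [Finset.mem_filter] at he ⊢
      exact ⟨he.1, hin e he.1 he.2, he.2 ▸ hv⟩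
    · push Not at h
      rw [Finset.filter_false_of_mem h]
      simp
  · refine (hfeas {t}ᶜ (fun x hx h => ht (h ▸ hx)) (by simp)).trans (Finset.card_le_card ?_)
    intro e he
    simp only [Finset.mem_filter] at he ⊢
    exact ⟨he.1, by simpa using he.2.2⟩

end Flow

/-! ### Topological numberings, paths and cuts. -/

namespace Network

variable (G : Network)

/-- The nodes of an acyclic network can be numbered along its channels. -/
theorem exists_numbering :
    ∃ τ : G.V → ℕ, Function.Injective τ ∧ ∀ e, τ (G.tail e) < τ (G.head e) := by
  let r : G.V → G.V → Prop := Relation.TransGen fun u u' => ∃ e, G.tail e = u ∧ G.head e = u'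
  let i := Fintype.equivFin G.V
  -- The number of strict ancestors increases along channels; an arbitrary enumeration in the lower
  -- digit breaks ties.
  refine ⟨fun v => {u | r u v}.ncard * Fintype.card G.V + i v, fun u v h => ?_, fun e => ?_⟩
  · have h1 : (i u : ℕ) = i v := by
      have := congrArg (· % Fintype.card G.V) h
      simpa [Nat.mul_add_mod_self_right, Nat.mod_eq_of_lt (i u).2, Nat.mod_eq_of_lt (i v).2]
        using this
    exact i.injective (Fin.ext h1)
  · have h1 : {u | r u (G.tail e)}.ncard < {u | r u (G.head e)}.ncard := by
      refine Set.ncard_lt_ncard ⟨fun u hu => hu.tail ⟨e, rfl, rfl⟩, fun h => ?_⟩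
      exact G.acyclic _ (h (Relation.TransGen.single ⟨e, rfl, rfl⟩ : r _ _))
    have h2 := Nat.mul_le_mul_right (Fintype.card G.V) h1
    have h3 := (i (G.tail e)).2
    rw [Nat.succ_mul] at h2
    change _ * _ + _ < _ * _ + _
    omega

theorem exists_channel_numbering (τ : G.V → ℕ) :
    ∃ ρ : G.E → ℕ, Function.Injective ρ ∧ ∀ d e, τ (G.tail d) < τ (G.tail e) → ρ d < ρ e := by
  let i := Fintype.equivFin G.E
  refine ⟨fun e => τ (G.tail e) * Fintype.card G.E + i e, fun u v h => ?_, fun d e h => ?_⟩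
  · have h1 : (i u : ℕ) = i v := by
      have := congrArg (· % Fintype.card G.E) h
      simpa [Nat.mul_add_mod_self_right, Nat.mod_eq_of_lt (i u).2, Nat.mod_eq_of_lt (i v).2]
        using this
    exact i.injective (Fin.ext h1)
  · have h2 := Nat.mul_le_mul_right (Fintype.card G.E) h
    have h3 := (i d).2
    rw [Nat.succ_mul] at h2
    change _ * _ + _ < _ * _ + _
    omega

theorem IsPath.exists_mem_cut {p : List G.E} {u v : G.V} (h : G.IsPath p u v) {A : Set G.V}
    (hu : u ∈ A) (hv : v ∉ A) : ∃ e ∈ p, G.tail e ∈ A ∧ G.head e ∉ A := by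
  induction p generalizing u with
  | nil => simp [IsPath] at h
  | cons e p ih =>
    obtain ⟨h1, h2, h3⟩ := h
    have h2 : G.tail e = u := by simpa using h2
    by_cases he : G.head e ∈ A
    · cases p with
      | nil => exact absurd he (by simpa using (by simpa using h3 : G.head e = v) ▸ hv)
      | cons e' p =>
        rw [List.isChain_cons_cons] at h1
        obtain ⟨d, hd, hd'⟩ := ih ⟨h1.2, by simpa using h1.1.symm, by simpa using h3⟩ he
        exact ⟨d, List.mem_cons_of_mem _ hd, hd'⟩
    · exact ⟨e, by simp, h2 ▸ hu, he⟩

theorem le_cutSize_of_paths {w : ℕ} {P : Fin w → List G.E} {u v : G.V}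
    (hP : ∀ j, G.IsPath (P j) u v) (hd : Pairwise fun i j => List.Disjoint (P i) (P j))
    (S : Finset G.E) (hS : ∀ j, ∀ e ∈ P j, e ∈ S) {A : Set G.V} (hu : u ∈ A) (hv : v ∉ A) :
    w ≤ cutSize G.tail G.head S A := by
  choose f hf hA using fun j => (hP j).exists_mem_cut G hu hv
  have hinj : Function.Injective f := by
    intro i j hij
    by_contra hne
    exact hd hne (hf i) (hij ▸ hf j)
  calc w = (Finset.univ.image f).card := by simp [Finset.card_image_of_injective _ hinj]
    _ ≤ _ := Finset.card_le_card fun e he => by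
      obtain ⟨j, -, rfl⟩ := Finset.mem_image.1 he
      exact Finset.mem_filter.2 ⟨hS j _ (hf j), hA j⟩

theorem cutSize_univ (A : Set G.V) : cutSize G.tail G.head Finset.univ A =
    Nat.card {e : G.E // G.tail e ∈ A ∧ G.head e ∉ A} := by
  rw [cutSize, Nat.card_eq_fintype_card, Fintype.card_subtype]

theorem le_minCut_iff {u v : G.V} (huv : u ≠ v) (w : ℕ) : w ≤ G.minCut u v ↔
    ∀ A : Set G.V, u ∈ A → v ∉ A → w ≤ cutSize G.tail G.head Finset.univ A := by
  constructor
  · intro h A hu hv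
    exact h.trans (Nat.sInf_le ⟨A, hu, hv, G.cutSize_univ A⟩)
  · intro h
    -- The cut `{u}` shows that the infimum is over a nonempty set, so it is not the default value
    -- 0.
    refine le_csInf ⟨_, {u}, rfl, by simpa using huv.symm, rfl⟩ ?_
    rintro _ ⟨A, hu, hv, rfl⟩
    exact G.cutSize_univ A ▸ h A hu hv

end Network

/-! ### Counting preimages of subspaces. -/

section LinearAlgebra

variable {F A M : Type} [Field F] [AddCommGroup A] [Module F A] [FiniteDimensional F A]
  [AddCommGroup M] [Module F M] [FiniteDimensional F M]

/-- Rank-nullity for `L` followed by the quotient map by `W`, and for that quotient map restricted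
to `range L ⊔ W`. -/
theorem finrank_comap_add (L : A →ₗ[F] M) (W : Submodule F M) :
    Module.finrank F (W.comap L) + Module.finrank F (LinearMap.range L ⊔ W : Submodule F M) =
      Module.finrank F A + Module.finrank F W := by
  have h1 := LinearMap.finrank_range_add_finrank_ker (W.mkQ ∘ₗ L)
  rw [LinearMap.ker_comp, Submodule.ker_mkQ, LinearMap.range_comp] at h1
  have h2 := LinearMap.finrank_range_add_finrank_ker (W.mkQ.domRestrict (LinearMap.range L ⊔ W))
  rw [LinearMap.range_domRestrict, Submodule.map_sup, Submodule.mkQ_map_self, sup_bot_eq,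
    LinearMap.ker_domRestrict, Submodule.ker_mkQ] at h2
  have h3 := (Submodule.comapSubtypeEquivOfLe (p := W) (q := LinearMap.range L ⊔ W)
    le_sup_right).finrank_eq
  change Module.finrank F (W.comap (LinearMap.range L ⊔ W).subtype) = _ at h3
  omega

theorem card_comap_mul_pow_le [Finite F] (L : A →ₗ[F] M) (W : Submodule F M) (c : ℕ)
    (h : c + Module.finrank F W ≤ Module.finrank F (LinearMap.range L ⊔ W : Submodule F M)) :
    Nat.card {x // L x ∈ W} * Nat.card F ^ c ≤ Nat.card A := by
  have h1 := finrank_comap_add L W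
  have h2 : Nat.card {x // L x ∈ W} = Nat.card F ^ Module.finrank F (W.comap L) :=
    Module.natCard_eq_pow_finrank (K := F) (V := W.comap L)
  rw [Module.natCard_eq_pow_finrank (K := F) (V := A), h2, ← pow_add]
  exact Nat.pow_le_pow_right Nat.card_pos (by omega)

theorem card_le_card_comap_mul [Finite F] (L : A →ₗ[F] M) (W : Submodule F M)
    (h : Module.finrank F (LinearMap.range L ⊔ W : Submodule F M) ≤ Module.finrank F W + 1) :
    Nat.card A ≤ Nat.card {x // L x ∈ W} * Nat.card F := by
  have h1 := finrank_comap_add L W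
  have h2 : Nat.card {x // L x ∈ W} = Nat.card F ^ Module.finrank F (W.comap L) :=
    Module.natCard_eq_pow_finrank (K := F) (V := W.comap L)
  rw [Module.natCard_eq_pow_finrank (K := F) (V := A), h2, ← pow_succ]
  exact Nat.pow_le_pow_right Nat.card_pos (by omega)

end LinearAlgebra

/-! ### Resampling the coefficients of one channel. -/

namespace Problem

variable (N : Problem) {F : Type} [Field F]

/-- The kernels of all channels, real or imaginary. -/
noncomputable def extKernel (k : N.Coeffs F) : N.E ⊕ Fin N.w → Fin N.w → F :=
  Sum.elim (N.kernel k) fun j => Pi.single j 1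

/-- The channels that enter the node which `e` leaves. -/
abbrev Incoming (e : N.E) : Type := {d : N.E ⊕ Fin N.w // N.entersAt d = N.tail e}

/-- The span of the kernels that enter the node which `e` leaves. -/
noncomputable def incomingSpan (k : N.Coeffs F) (e : N.E) : Submodule F (Fin N.w → F) :=
  Submodule.span F (Set.range fun d : N.Incoming e => N.extKernel k d.1)

/-- `D` is closed under upstream channels, and contains all channels that feed `e` but not `e`. -/
structure IsPast (D : Set N.E) (e : N.E) : Prop where
  closed : ∀ a ∈ D, ∀ d, N.head d = N.tail a → d ∈ D
  notMem : e ∉ D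
  feeds : ∀ d, N.head d = N.tail e → d ∈ D

/-- Two choices of coefficients that differ at most at the channel `e`. -/
def AgreeOff (e : N.E) (k k' : N.Coeffs F) : Prop := ∀ p : N.AdjPair, p.1.2 ≠ e → k p = k' p

/-- Replace the coefficients at the channel `e`. -/
noncomputable def resample (e : N.E) (k : N.Coeffs F) (x : N.Incoming e → F) : N.Coeffs F :=
  fun p => if h : p.1.2 = e then x ⟨p.1.1, h ▸ p.2⟩ else k p

/-- The coefficients at the channel `e`. -/
def coeffsAt (e : N.E) (k : N.Coeffs F) : N.Incoming e → F := fun d => k ⟨(d.1, e), d.2⟩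

variable {N}

theorem agreeOff_resample {F : Type} (e : N.E) (k : N.Coeffs F) (x : N.Incoming e → F) :
    N.AgreeOff e k (N.resample e k x) := fun p hp => by simp [resample, hp]

theorem coeffsAt_resample {F : Type} (e : N.E) (k : N.Coeffs F) (x : N.Incoming e → F) :
    N.coeffsAt e (N.resample e k x) = x := by
  ext d
  simp [coeffsAt, resample]

theorem resample_resample_coeffsAt {F : Type} (e : N.E) (k : N.Coeffs F) (x : N.Incoming e → F) :
    N.resample e (N.resample e k x) (N.coeffsAt e k) = k := by
  funext p
  obtain ⟨⟨d, a⟩, hp⟩ := p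
  by_cases h : a = e
  · subst h
    simp [coeffsAt, resample]
  · simp [resample, h]

/-- Both the given coefficients and fresh ones at `e` are uniform, so they can be exchanged. -/
theorem card_mul_card_coeffsAt {F : Type} [Finite F] {e : N.E} {Q : N.Coeffs F → Prop} (B : N.Coeffs F → Prop)
    (hQ : ∀ k k', N.AgreeOff e k k' → Q k → Q k') [Fintype (N.Coeffs F)] :
    Nat.card {k // Q k ∧ B k} * Nat.card (N.Incoming e → F) =
      ∑ k ∈ Finset.univ.filter Q, Nat.card {x // B (N.resample e k x)} := by
  have : Fintype F := Fintype.ofFinite F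
  have h1 : ∑ k ∈ Finset.univ.filter Q, Nat.card {x // B (N.resample e k x)} =
      (((Finset.univ.filter Q) ×ˢ (Finset.univ : Finset (N.Incoming e → F))).filter
        fun y => B (N.resample e y.1 y.2)).card := by
    rw [Finset.card_filter, Finset.sum_product]
    refine Finset.sum_congr rfl fun k _ => ?_
    rw [← Finset.card_filter, Nat.card_eq_fintype_card, Fintype.card_subtype]
  rw [h1, Nat.card_eq_fintype_card, Fintype.card_subtype, Nat.card_eq_fintype_card,
    ← Finset.card_univ, ← Finset.card_product]
  refine Finset.card_nbij' (fun y => (N.resample e y.1 y.2, N.coeffsAt e y.1))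
    (fun y => (N.resample e y.1 y.2, N.coeffsAt e y.1)) ?_ ?_ ?_ ?_
  · rintro ⟨k, x⟩ h
    simp only [Finset.coe_product, Set.mem_prod, Finset.mem_coe, Finset.mem_filter,
      Finset.mem_univ, true_and, and_true, Finset.mem_product, Finset.coe_filter, Set.mem_ofPred_eq,
      resample_resample_coeffsAt] at h ⊢
    exact ⟨hQ _ _ (agreeOff_resample e k x) h.1, h.2⟩
  · rintro ⟨k, x⟩ h
    simp only [Finset.coe_product, Set.mem_prod, Finset.mem_coe, Finset.mem_filter,
      Finset.mem_univ, true_and, and_true, Finset.mem_product, Finset.coe_filter, Set.mem_ofPred_eq]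
      at h ⊢
    exact ⟨hQ _ _ (agreeOff_resample e k x) h.1, h.2⟩
  · rintro ⟨k, x⟩ -
    simp [resample_resample_coeffsAt, coeffsAt_resample]
  · rintro ⟨k, x⟩ -
    simp [resample_resample_coeffsAt, coeffsAt_resample]

theorem kernel_congr {D : Set N.E} (hD : ∀ a ∈ D, ∀ d, N.head d = N.tail a → d ∈ D)
    {k k' : N.Coeffs F} (h : ∀ p : N.AdjPair, p.1.2 ∈ D → k p = k' p) :
    ∀ a ∈ D, N.kernel k a = N.kernel k' a := by
  intro a
  induction a using N.wellFounded_adj.induction with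
  | _ a ih =>
    intro ha
    rw [kernel_eq, kernel_eq]
    refine Finset.sum_congr rfl fun d _ => ?_
    rw [h ⟨(d.1, a), d.2⟩ ha]
    obtain ⟨d | j, hd⟩ := d
    · exact congrArg _ (ih d hd (hD a ha d hd))
    · rfl

theorem IsPast.kernel_eq {D : Set N.E} {e : N.E} (hD : N.IsPast D e) {k k' : N.Coeffs F}
    (h : N.AgreeOff e k k') : ∀ a ∈ D, N.kernel k a = N.kernel k' a :=
  kernel_congr hD.closed fun p hp => h p fun he => hD.notMem (he ▸ hp)

theorem IsPast.extKernel_eq {D : Set N.E} {e : N.E} (hD : N.IsPast D e) {k k' : N.Coeffs F}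
    (h : N.AgreeOff e k k') (d : N.Incoming e) : N.extKernel k d.1 = N.extKernel k' d.1 := by
  obtain ⟨d | j, hd⟩ := d
  · exact hD.kernel_eq h d (hD.feeds d hd)
  · rfl

theorem kernel_eq_sum (k : N.Coeffs F) (e : N.E) :
    N.kernel k e = ∑ d : N.Incoming e, N.coeffsAt e k d • N.extKernel k d.1 :=
  N.kernel_eq k e

theorem kernel_mem_incomingSpan (k : N.Coeffs F) (e : N.E) :
    N.kernel k e ∈ N.incomingSpan k e := by
  rw [kernel_eq_sum]
  exact Submodule.sum_mem _ fun d _ => Submodule.smul_mem _ _ (Submodule.subset_span ⟨d, rfl⟩)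

theorem IsPast.kernel_resample {D : Set N.E} {e : N.E} (hD : N.IsPast D e) (k : N.Coeffs F)
    (x : N.Incoming e → F) : N.kernel (N.resample e k x) e =
      Fintype.linearCombination F (fun d : N.Incoming e => N.extKernel k d.1) x := by
  rw [kernel_eq_sum, coeffsAt_resample, Fintype.linearCombination_apply]
  refine Finset.sum_congr rfl fun d _ => ?_
  rw [hD.extKernel_eq (agreeOff_resample e k x) d]

theorem range_linearCombination_extKernel (k : N.Coeffs F) (e : N.E) :
    LinearMap.range (Fintype.linearCombination F fun d : N.Incoming e => N.extKernel k d.1) =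
      N.incomingSpan k e := by
  rw [Fintype.range_linearCombination, incomingSpan]

theorem rank_decodingMatrix (k : N.Coeffs F) (t : N.V) :
    (N.decodingMatrix k t).rank = Module.finrank F
      (Submodule.span F (Set.range fun e : {e : N.E // N.head e = t} => N.kernel k e.1)) := by
  rw [Matrix.rank_eq_finrank_span_cols]
  rfl

variable [Finite F]

/-- With all other coefficients fixed, the kernel of `e` is a linear image, with range
`incomingSpan`, of its uniform coefficients. A subspace `W` that misses at least `c` dimensions of
that range is hit with probability at most q^(-c); averaging over the event `Q`, which does not see
those coefficients, gives the bound. -/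
theorem card_kernel_mem_mul_pow_le {e : N.E} {D : Set N.E} (hD : N.IsPast D e)
    {Q : N.Coeffs F → Prop} (hQ : ∀ k k', N.AgreeOff e k k' → Q k → Q k')
    {W : N.Coeffs F → Submodule F (Fin N.w → F)} (hW : ∀ k k', N.AgreeOff e k k' → W k = W k')
    (c : ℕ) (hc : ∀ k, Q k → c + Module.finrank F (W k) ≤
      Module.finrank F (N.incomingSpan k e ⊔ W k : Submodule F (Fin N.w → F))) :
    Nat.card {k // Q k ∧ N.kernel k e ∈ W k} * Nat.card F ^ c ≤ Nat.card {k // Q k} := by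
  have : Fintype F := Fintype.ofFinite F
  have h := card_mul_card_coeffsAt (fun k => N.kernel k e ∈ W k) hQ
  refine Nat.le_of_mul_le_mul_right ?_ (Nat.card_pos (α := N.Incoming e → F))
  rw [mul_right_comm, h, Finset.sum_mul, Nat.card_eq_fintype_card (α := {k // Q k}),
    Fintype.card_subtype, ← smul_eq_mul (a := Finset.card _)]
  refine Finset.sum_le_card_nsmul _ _ _ fun k hk => ?_
  simp only [← hW _ _ (agreeOff_resample e k _), hD.kernel_resample]
  refine card_comap_mul_pow_le _ _ c ?_
  rw [range_linearCombination_extKernel]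
  exact hc k (Finset.mem_filter.1 hk).2

/-- The converse estimate for the lower bound: a subspace that misses at most one dimension is hit
with conditional probability at least 1/q. -/
theorem card_le_card_kernel_mem_mul {e : N.E} {D : Set N.E} (hD : N.IsPast D e)
    {Q : N.Coeffs F → Prop} (hQ : ∀ k k', N.AgreeOff e k k' → Q k → Q k')
    {W : N.Coeffs F → Submodule F (Fin N.w → F)} (hW : ∀ k k', N.AgreeOff e k k' → W k = W k')
    (hc : ∀ k, Q k →
      Module.finrank F (N.incomingSpan k e ⊔ W k : Submodule F (Fin N.w → F)) ≤
        Module.finrank F (W k) + 1) :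
    Nat.card {k // Q k} ≤ Nat.card {k // Q k ∧ N.kernel k e ∈ W k} * Nat.card F := by
  have : Fintype F := Fintype.ofFinite F
  have h := card_mul_card_coeffsAt (fun k => N.kernel k e ∈ W k) hQ
  refine Nat.le_of_mul_le_mul_right ?_ (Nat.card_pos (α := N.Incoming e → F))
  rw [mul_right_comm, h, Finset.sum_mul, Nat.card_eq_fintype_card (α := {k // Q k}),
    Fintype.card_subtype, ← smul_eq_mul (a := Finset.card _)]
  refine Finset.card_nsmul_le_sum _ _ _ fun k hk => ?_
  simp only [← hW _ _ (agreeOff_resample e k _), hD.kernel_resample]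
  refine card_le_card_comap_mul _ _ ?_
  rw [range_linearCombination_extKernel]
  exact hc k (Finset.mem_filter.1 hk).2

end Problem

/-- Numberings of the nodes and of the channels along the direction of the channels. -/
structure Network.Numbering (G : Network) where
  node : G.V → ℕ
  chan : G.E → ℕ
  node_injective : Function.Injective node
  chan_injective : Function.Injective chan
  node_lt : ∀ e, node (G.tail e) < node (G.head e)
  chan_lt : ∀ d e, node (G.tail d) < node (G.tail e) → chan d < chan e

theorem Network.nonempty_numbering (G : Network) : Nonempty G.Numbering := by
  obtain ⟨τ, hτ, hlt⟩ := G.exists_numbering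
  obtain ⟨ρ, hρ, hρlt⟩ := G.exists_channel_numbering τ
  exact ⟨⟨τ, ρ, hτ, hρ, hlt, hρlt⟩⟩

/-! ### Flows towards a sink and their conservation laws. -/

namespace Problem

variable (N : Problem)

/-- The source and the sinks other than `t`. -/
def origins (t : N.V) : Set N.V := {v | v = N.s ∨ v ∈ N.T ∧ v ≠ t}

/-- The channels of `S` form a flow of value `w` from the source and the other sinks to `t`. -/
structure IsFlow (t : N.V) (S : Finset N.E) : Prop where
  balance : ∀ v ∉ N.origins t, v ≠ t →
    (S.filter fun e => N.head e = v).card = (S.filter fun e => N.tail e = v).card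
  head_notMem : ∀ e ∈ S, N.head e ∉ N.origins t
  tail_ne : ∀ e ∈ S, N.tail e ≠ t
  value : (S.filter fun e => N.head e = t).card = N.w

variable {N}

theorem exists_isFlow {t : N.V} (ht : t ∈ N.T) (S₀ : Finset N.E)
    (h : ∀ A : Set N.V, N.s ∈ A → t ∉ A → N.w ≤ cutSize N.tail N.head S₀ A) :
    ∃ S ⊆ S₀, N.IsFlow t S := by
  have hts : t ∉ N.origins t := by
    rintro (h | h)
    · exact N.source_notMem (h ▸ ht)
    · exact h.2 rfl
  obtain ⟨S, hS, h1, h2, h3, h4⟩ := exists_flow N.tail N.head (N.origins t) t hts S₀ N.w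
    fun A hA htA => h A (hA (Or.inl rfl)) htA
  exact ⟨S, hS, h1, h2, h3, h4⟩

variable (ν : N.Numbering)

theorem node_tail_le {d e : N.E} (h : ν.chan d < ν.chan e) :
    ν.node (N.tail d) ≤ ν.node (N.tail e) := by
  by_contra hlt
  exact absurd (ν.chan_lt e d (not_le.1 hlt)) (by omega)

theorem chan_lt_of_adj {d e : N.E} (h : N.head d = N.tail e) : ν.chan d < ν.chan e :=
  ν.chan_lt d e (h ▸ ν.node_lt d)

theorem isPast_lt (e : N.E) : N.IsPast {a | ν.chan a < ν.chan e} e where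
  closed _ ha _ hd := (chan_lt_of_adj ν hd).trans ha
  notMem := lt_irrefl (ν.chan e)
  feeds _ hd := chan_lt_of_adj ν hd

/-- The channels of `S` before `e` that lead beyond the tail of `e`. -/
noncomputable def cur (S : Finset N.E) (e : N.E) : Finset N.E :=
  S.filter fun d => ν.chan d < ν.chan e ∧ ν.node (N.tail e) < ν.node (N.head d)

/-- The class of a channel: its tail, where all nodes in `origins t` are identified. -/
noncomputable def tailClass (t : N.V) (e : N.E) : Option N.V :=
  if N.tail e ∈ N.origins t then none else some (N.tail e)

/-- The number of the channels in the class of `e` which are not before `e`. -/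
noncomputable def remaining (t : N.V) (S : Finset N.E) (e : N.E) : ℕ :=
  (S.filter fun d => tailClass t d = tailClass t e ∧ ν.chan e ≤ ν.chan d).card

/-- Count the flow channels whose head lies beyond the tail of `e`. They end at `t`, which happens
`w` times in all, or at internal nodes beyond it, where they are balanced by the channels leaving
those nodes. After cancelling the latter, what is left is `cur` together with the remaining channels
of the origin class. -/
theorem card_cur_add_remaining_le {t : N.V} {S : Finset N.E} (hS : N.IsFlow t S) {e : N.E}
    (he : N.tail e ∈ N.origins t) : (cur ν S e).card + remaining ν t S e ≤ N.w := by
  let v := N.tail e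
  have h1 : (cur ν S e).card + remaining ν t S e +
      (S.filter fun d => N.tail d ∉ N.origins t ∧ ν.node v < ν.node (N.tail d)).card =
      (S.filter fun d => ν.node v < ν.node (N.head d)).card := by
    simp only [cur, remaining, Finset.card_filter, ← Finset.sum_add_distrib]
    refine Finset.sum_congr rfl fun d _ => ?_
    have a1 := ν.node_lt d
    have a2 := ν.chan_lt d e
    have a3 := ν.chan_lt e d
    have a4 : tailClass t d = tailClass t e ↔ N.tail d ∈ N.origins t := by
      by_cases h : N.tail d ∈ N.origins t <;> simp [tailClass, he, h]
    simp only [a4]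
    by_cases h : N.tail d ∈ N.origins t
    · simp only [h, true_and, not_true_eq_false, false_and, if_false, v]
      split_ifs <;> omega
    · have a5 : ν.node (N.tail d) ≠ ν.node (N.tail e) := fun h' =>
        h (ν.node_injective h' ▸ he)
      simp only [h, true_and, not_false_eq_true, false_and, if_false, v]
      split_ifs <;> omega
  let X : Finset N.V := Finset.univ.filter fun x => x ∉ N.origins t ∧ x ≠ t ∧ ν.node v < ν.node x
  have h2 : (S.filter fun d => ν.node v < ν.node (N.head d)).card ≤
      (S.filter fun d => N.head d = t).card + (S.filter fun d => N.head d ∈ X).card := by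
    rw [← Finset.card_union_add_card_inter]
    refine (Finset.card_le_card fun d hd => ?_).trans (Nat.le_add_right _ _)
    obtain ⟨hd, hlt⟩ := Finset.mem_filter.1 hd
    by_cases h : N.head d = t
    · simp [hd, h]
    · simp [hd, h, X, hlt, hS.head_notMem d hd]
  have h3 : (S.filter fun d => N.head d ∈ X).card = (S.filter fun d => N.tail d ∈ X).card := by
    rw [Finset.card_eq_sum_card_fiberwise (f := N.head)
      (s := S.filter fun d => N.head d ∈ X) (t := X)
      (fun d hd => (Finset.mem_filter.1 hd).2),
      Finset.card_eq_sum_card_fiberwise (f := N.tail)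
      (s := S.filter fun d => N.tail d ∈ X) (t := X)
      (fun d hd => (Finset.mem_filter.1 hd).2)]
    refine Finset.sum_congr rfl fun x hx => ?_
    have hx' := (Finset.mem_filter.1 hx).2
    rw [Finset.filter_filter, Finset.filter_filter]
    convert hS.balance x hx'.1 hx'.2.1 using 2 <;> refine Finset.filter_congr fun d _ => ?_ <;>
      exact ⟨fun h => h.2, fun h => ⟨h ▸ hx, h⟩⟩
  have h4 : (S.filter fun d => N.tail d ∈ X).card =
      (S.filter fun d => N.tail d ∉ N.origins t ∧ ν.node v < ν.node (N.tail d)).card := by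
    congr 1
    refine Finset.filter_congr fun d hd => ?_
    simp [X, hS.tail_ne d hd]
  have h5 := hS.value
  omega

/-- The channels of `S` that lead from before the node `v` to `v` or beyond. -/
noncomputable def crossing (S : Finset N.E) (v : N.V) : Finset N.E :=
  S.filter fun d => ν.node (N.tail d) < ν.node v ∧ ν.node v ≤ ν.node (N.head d)

/-- Passing the internal tail of `e` replaces the channels of `crossing` that end there by equally
many that leave it; those already before `e` are in `cur`, the others are counted by `remaining`. -/
theorem card_cur_add_remaining_eq {t : N.V} {S : Finset N.E} (hS : N.IsFlow t S) {e : N.E}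
    (heS : e ∈ S) (he : N.tail e ∉ N.origins t) :
    (cur ν S e).card + remaining ν t S e = (crossing ν S (N.tail e)).card := by
  have h1 : (cur ν S e).card + remaining ν t S e +
      (S.filter fun d => N.head d = N.tail e).card =
      (crossing ν S (N.tail e)).card + (S.filter fun d => N.tail d = N.tail e).card := by
    simp only [cur, remaining, crossing, Finset.card_filter, ← Finset.sum_add_distrib]
    refine Finset.sum_congr rfl fun d _ => ?_
    have a1 := ν.node_lt d
    have a2 := ν.chan_lt d e
    have a3 := ν.chan_lt e d
    have a4 : tailClass t d = tailClass t e ↔ ν.node (N.tail d) = ν.node (N.tail e) := by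
      rw [ν.node_injective.eq_iff]
      by_cases h : N.tail d ∈ N.origins t
      · simpa [tailClass, he, h] using fun h' : N.tail d = N.tail e => he (h' ▸ h)
      · simp [tailClass, he, h]
    have a5 : N.head d = N.tail e ↔ ν.node (N.head d) = ν.node (N.tail e) :=
      ν.node_injective.eq_iff.symm
    have a6 : N.tail d = N.tail e ↔ ν.node (N.tail d) = ν.node (N.tail e) :=
      ν.node_injective.eq_iff.symm
    simp only [a4, a5, a6]
    split_ifs <;> omega
  have h2 := hS.balance _ he (hS.tail_ne e heS)
  omega

/-! ### The first dependent channel and the upper bound on the failure probability. -/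

variable {F : Type} [Field F]

/-- The span of the kernels of the channels in `cur ν S e`. -/
noncomputable def curSpan (S : Finset N.E) (k : N.Coeffs F) (e : N.E) :
    Submodule F (Fin N.w → F) :=
  Submodule.span F (N.kernel k '' (cur ν S e : Set N.E))

theorem finrank_curSpan_le (S : Finset N.E) (k : N.Coeffs F) (e : N.E) :
    Module.finrank F (curSpan ν S k e) ≤ (cur ν S e).card := by
  rw [curSpan, ← Finset.coe_image]
  exact (finrank_span_finset_le_card _).trans Finset.card_image_le

/-- Adding the channels of `Q` in order, each new kernel avoids the span of the earlier ones, since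
these all belong to its `cur`. -/
theorem finrank_span_kernel_eq {S Q : Finset N.E} {k : N.Coeffs F}
    (hQ : ∀ e ∈ Q, ∀ d ∈ Q, ν.chan d < ν.chan e → d ∈ cur ν S e)
    (hk : ∀ e ∈ Q, N.kernel k e ∉ curSpan ν S k e) :
    Module.finrank F (Submodule.span F (N.kernel k '' (Q : Set N.E))) = Q.card := by
  have hli : LinearIndepOn F (N.kernel k) (Q : Set N.E) := by
    induction Q using Finset.induction_on_max_value ν.chan with
    | empty => simp
    | insert a s has hmax ih =>
      rw [Finset.coe_insert]
      refine (ih (fun e he d hd => hQ e (Finset.mem_insert_of_mem he) d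
        (Finset.mem_insert_of_mem hd)) fun e he => hk e (Finset.mem_insert_of_mem he)).insert
        fun h => hk a (Finset.mem_insert_self _ _) (Submodule.span_mono (Set.image_mono ?_) h)
      intro d hd
      refine hQ a (Finset.mem_insert_self _ _) d (Finset.mem_insert_of_mem hd) ?_
      exact lt_of_le_of_ne (hmax d hd) fun h => has (ν.chan_injective h ▸ hd)
  have := finrank_span_eq_card hli
  rw [← Set.image_eq_range] at this
  simpa using this

theorem incomingSpan_eq_top {t : N.V} {k : N.Coeffs F} {e : N.E} (he : N.tail e ∈ N.origins t)
    (hk : N.tail e ∈ N.T → (N.decodingMatrix k (N.tail e)).rank = N.w) :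
    N.incomingSpan k e = ⊤ := by
  rcases he with he | he
  · rw [eq_top_iff, ← (Pi.basisFun F (Fin N.w)).span_eq]
    refine Submodule.span_mono ?_
    rintro _ ⟨j, rfl⟩
    exact ⟨⟨Sum.inr j, he.symm⟩, by simp [extKernel]⟩
  · have h := hk he.1
    rw [rank_decodingMatrix] at h
    have h1 := Submodule.eq_top_of_finrank_eq (h.trans (by simp))
    rw [eq_top_iff, ← h1]
    refine Submodule.span_mono ?_
    rintro _ ⟨d, rfl⟩
    exact ⟨⟨Sum.inl d.1, d.2⟩, rfl⟩

/-- At an origin the incoming span is everything, of dimension `w`. At an internal node the kernels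
of `crossing` are independent because no earlier channel was dependent, and each either enters the
tail of `e` or belongs to `cur`. In both cases conservation compares the dimension with `cur` plus
`remaining`. -/
theorem remaining_add_finrank_le {t : N.V} {S : Finset N.E} (hS : N.IsFlow t S) {e : N.E}
    (heS : e ∈ S) {k : N.Coeffs F}
    (hgood : ∀ d ∈ S, ν.chan d < ν.chan e → N.kernel k d ∉ curSpan ν S k d)
    (hk : N.tail e ∈ N.T → (N.decodingMatrix k (N.tail e)).rank = N.w) :
    remaining ν t S e + Module.finrank F (curSpan ν S k e) ≤
      Module.finrank F (N.incomingSpan k e ⊔ curSpan ν S k e : Submodule F (Fin N.w → F)) := by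
  have h0 := finrank_curSpan_le ν S k e
  by_cases he : N.tail e ∈ N.origins t
  · rw [incomingSpan_eq_top he hk, top_sup_eq, finrank_top, Module.finrank_fin_fun]
    have := card_cur_add_remaining_le ν hS he
    omega
  · have h1 := card_cur_add_remaining_eq ν hS heS he
    have h2 := finrank_span_kernel_eq ν (S := S) (Q := crossing ν S (N.tail e)) (k := k)
      (fun a ha d hd hlt => by
        simp only [crossing, cur, Finset.mem_filter] at ha hd ⊢
        exact ⟨hd.1, hlt, by omega⟩)
      (fun a ha => by
        simp only [crossing, Finset.mem_filter] at ha
        exact hgood a ha.1 (ν.chan_lt _ _ ha.2.1))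
    have h3 : Submodule.span F (N.kernel k '' (crossing ν S (N.tail e) : Set N.E)) ≤
        N.incomingSpan k e ⊔ curSpan ν S k e := by
      rw [Submodule.span_le]
      rintro _ ⟨d, hd, rfl⟩
      simp only [crossing, Finset.coe_filter, Set.mem_ofPred_eq] at hd
      rcases hd.2.2.eq_or_lt with h | h
      · exact Submodule.mem_sup_left (Submodule.subset_span
          ⟨⟨Sum.inl d, (ν.node_injective h).symm⟩, rfl⟩)
      · exact Submodule.mem_sup_right (Submodule.subset_span
          ⟨d, Finset.mem_filter.2 ⟨hd.1, ν.chan_lt _ _ hd.2.1, h⟩, rfl⟩)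
    have h4 := Submodule.finrank_mono h3
    omega

/-- The event that `e` is the first channel of `S` whose kernel is spanned by those in
`cur ν S e`, while the tail of `e` can decode if it is a sink. -/
def FirstDependent (S : Finset N.E) (e : N.E) (k : N.Coeffs F) : Prop :=
  ((∀ d ∈ S, ν.chan d < ν.chan e → N.kernel k d ∉ curSpan ν S k d) ∧
    (N.tail e ∈ N.T → (N.decodingMatrix k (N.tail e)).rank = N.w)) ∧
      N.kernel k e ∈ curSpan ν S k e

theorem curSpan_congr (S : Finset N.E) {e : N.E} {k k' : N.Coeffs F} (h : N.AgreeOff e k k')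
    {a : N.E} (ha : ν.chan a ≤ ν.chan e) : curSpan ν S k a = curSpan ν S k' a := by
  rw [curSpan, curSpan, Set.image_congr fun d hd => ?_]
  exact (isPast_lt ν e).kernel_eq h d ((Finset.mem_filter.1 hd).2.1.trans_le ha)

theorem card_firstDependent_mul_le [Finite F] {t : N.V} {S : Finset N.E} (hS : N.IsFlow t S)
    {e : N.E} (heS : e ∈ S) :
    Nat.card {k : N.Coeffs F // FirstDependent ν S e k} * Nat.card F ^ remaining ν t S e ≤
      Nat.card (N.Coeffs F) := by
  let Q : N.Coeffs F → Prop := fun k =>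
    (∀ d ∈ S, ν.chan d < ν.chan e → N.kernel k d ∉ curSpan ν S k d) ∧
      (N.tail e ∈ N.T → (N.decodingMatrix k (N.tail e)).rank = N.w)
  let W : N.Coeffs F → Submodule F (Fin N.w → F) := fun k => curSpan ν S k e
  have hW : ∀ k k', N.AgreeOff e k k' → W k = W k' := fun k k' h => curSpan_congr ν S h le_rfl
  have hc : ∀ k, Q k → remaining ν t S e + Module.finrank F (W k) ≤
      Module.finrank F (N.incomingSpan k e ⊔ W k : Submodule F (Fin N.w → F)) :=
    fun k hk => remaining_add_finrank_le ν hS heS hk.1 hk.2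
  have hQ : ∀ k k', N.AgreeOff e k k' → Q k → Q k' := by
    rintro k k' h ⟨h1, h2⟩
    refine ⟨fun d hd hlt => ?_, fun he => ?_⟩
    · rw [← curSpan_congr ν S h hlt.le, ← (isPast_lt ν e).kernel_eq h d hlt]
      exact h1 d hd hlt
    · refine Eq.trans (congrArg Matrix.rank ?_) (h2 he)
      ext i d
      exact congrFun ((isPast_lt ν e).kernel_eq h d.1 (chan_lt_of_adj ν d.2)).symm i
  have h := card_kernel_mem_mul_pow_le (isPast_lt ν e) hQ hW (remaining ν t S e) hc
  exact h.trans (Nat.card_le_card_of_injective (Subtype.val : {k // Q k} → N.Coeffs F)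
    Subtype.val_injective)

theorem exists_firstDependent (S : N.V → Finset N.E) (hS : ∀ t ∈ N.T, N.IsFlow t (S t))
    {k : N.Coeffs F} (hk : ∃ t ∈ N.T, (N.decodingMatrix k t).rank < N.w) :
    ∃ t ∈ N.T, ∃ e ∈ S t, FirstDependent ν (S t) e k := by
  obtain ⟨t₀, ht₀, hrk₀⟩ := hk
  -- Among the failing sinks take the first one, so that every sink upstream of it decodes.
  obtain ⟨t, ht, hmin⟩ := Finset.exists_min_image
    (N.T.filter fun t => (N.decodingMatrix k t).rank < N.w) ν.node
    ⟨t₀, Finset.mem_filter.2 ⟨ht₀, hrk₀⟩⟩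
  obtain ⟨htT, hrk⟩ := Finset.mem_filter.1 ht
  -- Otherwise the `w` flow channels into `t` would have independent kernels and `t` could decode.
  have h1 : ∃ e ∈ S t, N.head e = t ∧ N.kernel k e ∈ curSpan ν (S t) k e := by
    by_contra! hcon
    have h2 := finrank_span_kernel_eq ν (S := S t) (Q := (S t).filter fun e => N.head e = t)
      (k := k) (fun a ha d hd hlt => by
        simp only [cur, Finset.mem_filter] at ha hd ⊢
        exact ⟨hd.1, hlt, by rw [hd.2, ← ha.2]; exact ν.node_lt a⟩)
      (fun a ha => hcon a (Finset.mem_filter.1 ha).1 (Finset.mem_filter.1 ha).2)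
    rw [(hS t htT).value] at h2
    rw [rank_decodingMatrix] at hrk
    refine absurd hrk (not_lt.2 (h2.symm.le.trans
      (Submodule.finrank_mono (Submodule.span_mono ?_))))
    rintro _ ⟨e, he, rfl⟩
    exact ⟨⟨e, (Finset.mem_filter.1 he).2⟩, rfl⟩
  obtain ⟨e₁, he₁, hhead, hdep₁⟩ := h1
  obtain ⟨e, he, hemin⟩ := Finset.exists_min_image
    ((S t).filter fun e => N.kernel k e ∈ curSpan ν (S t) k e) ν.chan
    ⟨e₁, Finset.mem_filter.2 ⟨he₁, hdep₁⟩⟩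
  obtain ⟨heS, hdep⟩ := Finset.mem_filter.1 he
  refine ⟨t, htT, e, heS, ⟨fun d hd hlt hmem => ?_, fun heT => ?_⟩, hdep⟩
  · exact absurd (hemin d (Finset.mem_filter.2 ⟨hd, hmem⟩)) (not_le.2 hlt)
  -- The tail of `e` is not after the tail of `e₁`, hence strictly before `t`; as a failing sink it
  -- would contradict the choice of `t`.
  · refine ((Matrix.rank_le_card_height _).trans (by simp)).antisymm (not_lt.1 fun hlt => ?_)
    have h2 := hmin _ (Finset.mem_filter.2 ⟨heT, hlt⟩)
    have h3 : ν.node (N.tail e) ≤ ν.node (N.tail e₁) := by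
      rcases (hemin e₁ (Finset.mem_filter.2 ⟨he₁, hdep₁⟩)).eq_or_lt with h | h
      · rw [ν.chan_injective h]
      · exact node_tail_le ν h
    have h4 := ν.node_lt e₁
    rw [hhead] at h4
    omega

theorem remaining_pos {t : N.V} {S : Finset N.E} {e : N.E} (he : e ∈ S) :
    0 < remaining ν t S e :=
  Finset.card_pos.2 ⟨e, by simp [he]⟩

/-- The internal nodes that the channels of `S` leave. -/
noncomputable def tailNodes (S : Finset N.E) : Finset N.V :=
  (S.image N.tail).filter fun v => v ∈ N.internalNodes

/-- Such a channel is the last of its class, and the classes are the internal tails plus the single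
class of all origins, which contributes the 1. -/
theorem card_remaining_eq_one_le {t : N.V} {S : Finset N.E} (hS : N.IsFlow t S) :
    (S.filter fun e => remaining ν t S e = 1).card ≤ 1 + (tailNodes S).card := by
  have hinj : ∀ d ∈ S, ∀ e ∈ S, remaining ν t S d = 1 → tailClass t d = tailClass t e →
      ν.chan d ≤ ν.chan e → d = e := by
    intro d hd e he h1 hc hle
    obtain ⟨a, ha⟩ := Finset.card_eq_one.1 h1
    have hd' : d ∈ ({a} : Finset N.E) := ha ▸ Finset.mem_filter.2 ⟨hd, rfl, le_rfl⟩
    have he' : e ∈ ({a} : Finset N.E) := ha ▸ Finset.mem_filter.2 ⟨he, hc.symm, hle⟩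
    rw [Finset.mem_singleton.1 hd', Finset.mem_singleton.1 he']
  calc _ ≤ (insert none ((tailNodes S).image some)).card := by
        refine Finset.card_le_card_of_injOn (tailClass t) (fun e he => ?_) fun d hd e he h => ?_
        · obtain ⟨heS, -⟩ := Finset.mem_filter.1 he
          by_cases h : N.tail e ∈ N.origins t
          · simp [tailClass, h]
          · have h1 : N.tail e ∈ N.internalNodes :=
              ⟨fun h' => h (Or.inl h'), fun h' => h (Or.inr ⟨h', hS.tail_ne e heS⟩)⟩
            simp only [tailClass, h, if_false, Finset.coe_insert, Set.mem_insert_iff,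
              Finset.mem_coe, Finset.mem_image]
            exact Or.inr ⟨_, Finset.mem_filter.2 ⟨Finset.mem_image_of_mem _ heS, h1⟩, rfl⟩
        · obtain ⟨hd, hd1⟩ := Finset.mem_filter.1 hd
          obtain ⟨he, he1⟩ := Finset.mem_filter.1 he
          rcases le_total (ν.chan d) (ν.chan e) with hle | hle
          · exact hinj d hd e he hd1 h hle
          · exact (hinj e he d hd he1 h.symm hle).symm
    _ ≤ (tailNodes S).card + 1 := (Finset.card_insert_le _ _).trans
        (Nat.add_le_add_right Finset.card_image_le 1)
    _ = _ := add_comm _ _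

theorem failureProb_le [Finite F] (S : N.V → Finset N.E) (hS : ∀ t ∈ N.T, N.IsFlow t (S t)) :
    N.failureProb F ≤ (∑ t ∈ N.T, (1 + (tailNodes (S t)).card) : ℕ) / (Nat.card F : ℝ) +
      (∑ t ∈ N.T, (S t).card : ℕ) / (Nat.card F : ℝ) ^ 2 := by
  obtain ⟨ν⟩ := N.nonempty_numbering
  have : Fintype F := Fintype.ofFinite F
  have hq : (1 : ℝ) ≤ Nat.card F := by exact_mod_cast Nat.card_pos (α := F)
  have hK : (0 : ℝ) < Nat.card (N.Coeffs F) := by exact_mod_cast Nat.card_pos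
  have h1 : Nat.card {k : N.Coeffs F // ∃ t ∈ N.T, (N.decodingMatrix k t).rank < N.w} ≤
      ∑ t ∈ N.T, ∑ e ∈ S t, Nat.card {k : N.Coeffs F // FirstDependent ν (S t) e k} := by
    simp only [Nat.card_eq_fintype_card, Fintype.card_subtype]
    calc _ ≤ (N.T.biUnion fun t => (S t).biUnion fun e =>
          Finset.univ.filter fun k : N.Coeffs F => FirstDependent ν (S t) e k).card := by
          refine Finset.card_le_card fun k hk => ?_
          obtain ⟨t, ht, e, he, h⟩ := exists_firstDependent ν S hS (Finset.mem_filter.1 hk).2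
          simp only [Finset.mem_biUnion, Finset.mem_filter, Finset.mem_univ, true_and]
          exact ⟨t, ht, e, he, h⟩
      _ ≤ _ := Finset.card_biUnion_le.trans (Finset.sum_le_sum fun t _ => Finset.card_biUnion_le)
  -- Channels that are not last in their class cost at most 1/q², which disappears in the limit.
  have h2 : ∀ t ∈ N.T, ∀ e ∈ S t,
      (Nat.card {k : N.Coeffs F // FirstDependent ν (S t) e k} : ℝ) / Nat.card (N.Coeffs F) ≤
        (if remaining ν t (S t) e = 1 then 1 / (Nat.card F : ℝ) else 0) +
          1 / (Nat.card F : ℝ) ^ 2 := by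
    intro t ht e he
    have h3 : (Nat.card {k : N.Coeffs F // FirstDependent ν (S t) e k} : ℝ) *
        (Nat.card F : ℝ) ^ remaining ν t (S t) e ≤ Nat.card (N.Coeffs F) := by
      exact_mod_cast card_firstDependent_mul_le ν (hS t ht) he
    have h4 : (Nat.card {k : N.Coeffs F // FirstDependent ν (S t) e k} : ℝ) /
        Nat.card (N.Coeffs F) ≤ 1 / (Nat.card F : ℝ) ^ remaining ν t (S t) e := by
      rw [div_le_div_iff₀ hK (by positivity), one_mul]
      exact h3
    refine h4.trans ?_
    have h5 := remaining_pos ν (t := t) he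
    split_ifs with h
    · rw [h, pow_one]
      exact le_add_of_nonneg_right (by positivity)
    · rw [zero_add]
      exact one_div_le_one_div_of_le (by positivity) (pow_le_pow_right₀ hq (by omega))
  calc N.failureProb F ≤ (∑ t ∈ N.T, ∑ e ∈ S t,
          (Nat.card {k : N.Coeffs F // FirstDependent ν (S t) e k} : ℝ)) /
            Nat.card (N.Coeffs F) := by
        rw [failureProb]
        gcongr
        exact_mod_cast h1
    _ ≤ ∑ t ∈ N.T, ∑ e ∈ S t, ((if remaining ν t (S t) e = 1 then 1 / (Nat.card F : ℝ) else 0) +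
          1 / (Nat.card F : ℝ) ^ 2) := by
        simp only [Finset.sum_div]
        exact Finset.sum_le_sum fun t ht => Finset.sum_le_sum fun e he => h2 t ht e he
    _ ≤ ∑ t ∈ N.T, (((1 + (tailNodes (S t)).card : ℕ) : ℝ) * (1 / (Nat.card F : ℝ)) +
          (S t).card * (1 / (Nat.card F : ℝ) ^ 2)) := by
        refine Finset.sum_le_sum fun t ht => ?_
        rw [Finset.sum_add_distrib, ← Finset.sum_filter, Finset.sum_const, Finset.sum_const,
          nsmul_eq_mul, nsmul_eq_mul]
        gcongr
        exact card_remaining_eq_one_le ν (hS t ht)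
    _ = _ := by
        rw [Finset.sum_add_distrib, ← Finset.sum_mul, ← Finset.sum_mul]
        push_cast
        ring

end Problem

/-! ### Passing to the limit of large fields, and the upper bounds on Ω. -/

theorem FinField.neBot_comap_card : NeBot (comap FinField.card atTop) := by
  rw [comap_neBot_iff]
  intro s hs
  obtain ⟨n, hn⟩ := mem_atTop_sets.1 hs
  obtain ⟨p, hp, hprime⟩ := Nat.exists_infinite_primes n
  have := Fact.mk hprime
  exact ⟨⟨ZMod p⟩, hn _ (by simpa [FinField.card] using hp)⟩

theorem FinField.tendsto_add_div_card (a b : ℝ) :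
    Tendsto (fun F : FinField => ((a + b / F.card : ℝ) : EReal)) (comap FinField.card atTop)
      (𝓝 (a : EReal)) := by
  have h : Tendsto (fun n : ℕ => a + b / (n : ℝ)) atTop (𝓝 (a + 0)) :=
    tendsto_const_nhds.add (tendsto_const_div_atTop_nhds_zero_nat b)
  rw [add_zero] at h
  exact (continuous_coe_real_ereal.tendsto a).comp (h.comp tendsto_comap)

theorem FinField.card_pos (F : FinField) : 0 < F.card := Nat.card_pos

/-- With `x = 1 / q`, the quadratic error still vanishes after multiplication by q. -/
theorem one_sub_pow_le (x : ℝ) (h0 : 0 ≤ x) (h1 : x ≤ 1) (M : ℕ) :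
    (1 - x) ^ M ≤ 1 - M * x + M ^ 2 * x ^ 2 := by
  induction M with
  | zero => simp
  | succ M ih =>
    have h2 := mul_le_mul_of_nonneg_right ih (sub_nonneg.2 h1)
    have h3 : 0 ≤ (M : ℝ) ^ 2 * x ^ 3 := by positivity
    have h4 : 0 ≤ ((M : ℝ) + 1) * x ^ 2 := by positivity
    rw [pow_succ]
    push_cast
    nlinarith

namespace Problem

theorem Omega_le {N : Problem} (a : ℕ) (b : ℝ)
    (h : ∀ F : FinField, N.failureProb F.carrier ≤ a / (F.card : ℝ) + b / (F.card : ℝ) ^ 2) :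
    N.Omega ≤ ((a : ℝ) : EReal) := by
  have := FinField.neBot_comap_card
  rw [← (FinField.tendsto_add_div_card a b).limsup_eq]
  refine limsup_le_limsup (Eventually.of_forall fun F => ?_)
  have hq : (0 : ℝ) < F.card := by exact_mod_cast F.card_pos
  refine EReal.coe_le_coe_iff.2 ((mul_le_mul_of_nonneg_left (h F) hq.le).trans_eq ?_)
  field_simp

theorem le_Omega {N : Problem} (M : ℕ)
    (h : ∀ F : FinField, 1 - (1 - 1 / (F.card : ℝ)) ^ M ≤ N.failureProb F.carrier) :
    ((M : ℝ) : EReal) ≤ N.Omega := by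
  have := FinField.neBot_comap_card
  rw [← (FinField.tendsto_add_div_card M (-(M : ℝ) ^ 2)).limsup_eq]
  refine limsup_le_limsup (Eventually.of_forall fun F => ?_)
  have hq : (1 : ℝ) ≤ F.card := by exact_mod_cast F.card_pos
  have hq0 : (0 : ℝ) < F.card := by linarith
  have h1 := one_sub_pow_le (1 / (F.card : ℝ)) (by positivity)
    ((div_le_one hq0).2 hq) M
  refine EReal.coe_le_coe_iff.2 (le_trans ?_ (mul_le_mul_of_nonneg_left (h F) hq0.le))
  refine le_trans (le_of_eq ?_) (mul_le_mul_of_nonneg_left (sub_le_sub_left h1 1) hq0.le)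
  field_simp
  ring

theorem Omega_le_of_isFlow {N : Problem} (S : N.V → Finset N.E)
    (hS : ∀ t ∈ N.T, N.IsFlow t (S t)) {a : ℕ}
    (ha : ∑ t ∈ N.T, (1 + (tailNodes (S t)).card) ≤ a) : N.Omega ≤ ((a : ℝ) : EReal) := by
  refine Omega_le a (∑ t ∈ N.T, (S t).card : ℕ) fun F => (failureProb_le S hS).trans ?_
  refine add_le_add_left ?_ _
  have : (0 : ℝ) ≤ Nat.card F.carrier := by positivity
  exact div_le_div_of_nonneg_right (by exact_mod_cast ha) this

theorem Omega_le_of_mem_pathBounded {N : Problem} {n l : ℕ} (h : N ∈ pathBounded n l) :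
    N.Omega ≤ (((l + n : ℕ) : ℝ) : EReal) := by
  obtain ⟨hl, P, hP, hn⟩ := h
  -- Only the channels of the given paths are offered to the flow, so the internal nodes it leaves
  -- lie on those paths.
  let S₀ : N.V → Finset N.E := fun t => Finset.univ.filter fun e => ∃ j, e ∈ P t j
  have hex : ∀ t, ∃ S ⊆ S₀ t, t ∈ N.T → N.IsFlow t S := by
    intro t
    by_cases ht : t ∈ N.T
    · obtain ⟨S, h1, h2⟩ := exists_isFlow ht (S₀ t) fun A hs htA =>
        N.le_cutSize_of_paths (hP t ht).1 (hP t ht).2 (S₀ t)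
          (fun j e he => by simpa [S₀] using ⟨j, he⟩) hs htA
      exact ⟨S, h1, fun _ => h2⟩
    · exact ⟨∅, by simp, fun h => absurd h ht⟩
  choose S hS hflow using hex
  refine Omega_le_of_isFlow S hflow ?_
  rw [Finset.sum_add_distrib, Finset.sum_const, smul_eq_mul, mul_one, hl]
  refine Nat.add_le_add_left (le_trans (Finset.sum_le_sum fun t ht => ?_) hn) l
  rw [internalCount, ← Set.ncard_coe_finset]
  refine Set.ncard_le_ncard (fun v hv => ?_) (Set.toFinite _)
  obtain ⟨hv, hint⟩ := Finset.mem_filter.1 hv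
  obtain ⟨e, he, rfl⟩ := Finset.mem_image.1 hv
  obtain ⟨j, hj⟩ := (Finset.mem_filter.1 (hS t he)).2
  exact ⟨hint, j, e, hj, Or.inl rfl⟩

theorem Omega_le_of_mem_internalFixed {N : Problem} {m l : ℕ} (h : N ∈ internalFixed m l) :
    N.Omega ≤ (((l * (1 + m) : ℕ) : ℝ) : EReal) := by
  obtain ⟨hm, hl⟩ := h
  have hex : ∀ t, ∃ S, t ∈ N.T → N.IsFlow t S := by
    intro t
    by_cases ht : t ∈ N.T
    · have hst : N.s ≠ t := fun h => N.source_notMem (h ▸ ht)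
      obtain ⟨S, -, h2⟩ := exists_isFlow ht Finset.univ
        ((N.le_minCut_iff hst N.w).1 (N.rate_le t ht))
      exact ⟨S, fun _ => h2⟩
    · exact ⟨∅, fun h => absurd h ht⟩
  choose S hflow using hex
  refine Omega_le_of_isFlow S hflow ?_
  rw [← hl, ← smul_eq_mul]
  refine Finset.sum_le_card_nsmul _ _ _ fun t _ => Nat.add_le_add_left ?_ 1
  rw [← hm, ← Set.ncard_coe_finset]
  exact Set.ncard_le_ncard (fun v hv => (Finset.mem_filter.1 hv).2) (Set.toFinite _)

end Problem

/-! ### The extremal ladder networks. -/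

section Ladder

variable (m l : ℕ) (D : Fin l → Prop)

/-- The rung at which the `j`-th channel into the sink `t` starts. -/
noncomputable def rung {m l : ℕ} (D : Fin l → Prop) (p : Fin l × Fin (m + 1)) : Fin (m + 1) :=
  if D p.1 then p.2 else 0

theorem rung_le {m l : ℕ} (D : Fin l → Prop) (p : Fin l × Fin (m + 1)) : rung D p ≤ p.2 := by
  rw [rung]
  split_ifs
  · exact le_rfl
  · exact Fin.zero_le _

/-- The chain `0 → 1 → ⋯ → m` of nodes, with `m - a` parallel channels from `a` to `a + 1`, and
with `m + 1` channels into each of `l` sinks: one from each node of the chain into the sinks in `D`,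
and all of them from the node `0` into the other sinks. -/
noncomputable def ladder : Network where
  V := Fin (m + 1) ⊕ Fin l
  E := {p : Fin (m + 1) × Fin (m + 1) // p.1 < p.2} ⊕ (Fin l × Fin (m + 1))
  tail := Sum.elim (fun p => Sum.inl p.1.1) fun p => Sum.inl (rung D p)
  head := Sum.elim (fun p => Sum.inl ⟨p.1.1 + 1, by have := p.2; omega⟩) fun p => Sum.inr p.1
  acyclic := by
    let h : Fin (m + 1) ⊕ Fin l → ℕ := Sum.elim (fun a => a) fun _ => m + 1
    suffices H : ∀ u v, Relation.TransGen (fun u u' => ∃ e : {p : Fin (m + 1) × Fin (m + 1) //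
        p.1 < p.2} ⊕ (Fin l × Fin (m + 1)), Sum.elim (fun p => Sum.inl p.1.1)
          (fun p => Sum.inl (rung D p)) e = u ∧
        Sum.elim (fun p => Sum.inl ⟨p.1.1 + 1, by have := p.2; omega⟩)
          (fun p => Sum.inr p.1) e = u') u v → h u < h v from
      fun v hv => lt_irrefl _ (H v v hv)
    have hstep : ∀ e : {p : Fin (m + 1) × Fin (m + 1) // p.1 < p.2} ⊕ (Fin l × Fin (m + 1)),
        h (Sum.elim (fun p => Sum.inl p.1.1) (fun p => Sum.inl (rung D p)) e) <
          h (Sum.elim (fun p => Sum.inl ⟨p.1.1 + 1, by have := p.2; omega⟩)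
            (fun p => Sum.inr p.1) e) := by
      rintro (p | p)
      · simp [h]
      · exact (rung D p).2
    intro u v huv
    induction huv with
    | single hb =>
      obtain ⟨e, rfl, rfl⟩ := hb
      exact hstep e
    | tail _ hb ih =>
      obtain ⟨e, rfl, rfl⟩ := hb
      exact ih.trans (hstep e)

theorem Network.IsPath.cons {G : Network} {e : G.E} {p : List G.E} {v : G.V}
    (h : G.IsPath p (G.head e) v) : G.IsPath (e :: p) (G.tail e) v := by
  obtain ⟨h1, h2, h3⟩ := h
  cases p with
  | nil => simp at h2
  | cons d p =>
    refine ⟨List.isChain_cons_cons.2 ⟨?_, h1⟩, rfl, by simpa using h3⟩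
    simpa using h2.symm

/-- The last `d + 1` channels of the path along the chain into the `j`-th channel of a sink. -/
noncomputable def ladderPath (p : Fin l × Fin (m + 1)) : ℕ → List (ladder m l D).E
  | 0 => [Sum.inr p]
  | d + 1 =>
    if h : d + 1 ≤ (rung D p : ℕ) then
      Sum.inl ⟨(⟨rung D p - (d + 1), by have := (rung D p).2; omega⟩, p.2), by
        have := rung_le D p
        rw [Fin.le_def] at this
        rw [Fin.lt_def]
        simp only
        omega⟩ :: ladderPath p d
    else []

theorem isPath_ladderPath (p : Fin l × Fin (m + 1)) (d : ℕ) (hd : d ≤ (rung D p : ℕ)) :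
    (ladder m l D).IsPath (ladderPath m l D p d)
      (Sum.inl ⟨rung D p - d, by have := (rung D p).2; omega⟩) (Sum.inr p.1) := by
  induction d with
  | zero => exact ⟨List.isChain_singleton _, rfl, rfl⟩
  | succ d ih =>
    rw [ladderPath, dif_pos hd]
    refine Network.IsPath.cons (G := ladder m l D) ?_
    refine Eq.subst (motive := fun a => (ladder m l D).IsPath (ladderPath m l D p d)
      (Sum.inl a : Fin (m + 1) ⊕ Fin l) (Sum.inr p.1)) (Fin.ext ?_) (ih (by omega))
    simp only
    omega

/-- The number of the parallel channel. -/
def ladderLabel : (ladder m l D).E → Fin (m + 1) :=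
  Sum.elim (fun p => p.1.2) fun p => p.2

theorem ladderLabel_of_mem (p : Fin l × Fin (m + 1)) (d : ℕ) :
    ∀ e ∈ ladderPath m l D p d, ladderLabel m l D e = p.2 := by
  induction d with
  | zero =>
    intro e he
    obtain rfl := List.mem_singleton.1 he
    rfl
  | succ d ih =>
    intro e he
    rw [ladderPath] at he
    split_ifs at he with h
    · rcases List.mem_cons.1 he with rfl | he
      · rfl
      · exact ih e he
    · simp at he

/-- The path from the node `0` to the `j`-th channel of a sink. -/
noncomputable def fullPath (t : Fin l) (j : Fin (m + 1)) : List (ladder m l D).E :=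
  ladderPath m l D (t, j) (rung D (t, j))

theorem isPath_fullPath (t : Fin l) (j : Fin (m + 1)) :
    (ladder m l D).IsPath (fullPath m l D t j) (Sum.inl 0) (Sum.inr t) := by
  refine Eq.subst (motive := fun a => (ladder m l D).IsPath (fullPath m l D t j)
    (Sum.inl a : Fin (m + 1) ⊕ Fin l) (Sum.inr t)) (Fin.ext ?_)
    (isPath_ladderPath m l D (t, j) _ le_rfl)
  simp

theorem disjoint_fullPath (t : Fin l) :
    Pairwise fun i j => List.Disjoint (fullPath m l D t i) (fullPath m l D t j) := by
  intro i j hij e hi hj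
  exact hij ((ladderLabel_of_mem m l D _ _ e hi).symm.trans (ladderLabel_of_mem m l D _ _ e hj))

/-- The problem of transmitting at rate `m + 1` in the network `ladder m l D`. -/
noncomputable def ladderProblem : Problem where
  toNetwork := ladder m l D
  s := Sum.inl 0
  T := Finset.univ.map Function.Embedding.inr
  w := m + 1
  source_notMem h := by
    obtain ⟨t, -, h⟩ := Finset.mem_map.1 h
    exact Sum.inr_ne_inl h
  rate_pos := by omega
  rate_le := by
    intro t ht
    obtain ⟨t, -, rfl⟩ := Finset.mem_map.1 ht
    refine ((ladder m l D).le_minCut_iff (fun h => Sum.inl_ne_inr h) _).2 fun A hs ht => ?_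
    exact (ladder m l D).le_cutSize_of_paths (isPath_fullPath m l D t) (disjoint_fullPath m l D t)
      Finset.univ (by simp) hs ht

theorem card_sinks_ladderProblem : (ladderProblem m l D).T.card = l := by
  change (Finset.univ.map Function.Embedding.inr).card = l
  simp

theorem internalNodes_ladderProblem : (ladderProblem m l D).internalNodes =
    Set.range fun i : Fin m => (Sum.inl i.succ : Fin (m + 1) ⊕ Fin l) := by
  ext v
  constructor
  · rintro ⟨h1, h2⟩
    rcases v with a | t
    · obtain ⟨i, rfl⟩ := Fin.exists_succ_eq.2 fun h : a = 0 => h1 (congrArg Sum.inl h)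
      exact ⟨i, rfl⟩
    · exact absurd (Finset.mem_map.2 ⟨t, Finset.mem_univ _, rfl⟩) h2
  · rintro ⟨i, rfl⟩
    refine ⟨fun h => Fin.succ_ne_zero i (Sum.inl_injective h), fun h => ?_⟩
    obtain ⟨t, -, h⟩ := Finset.mem_map.1 h
    exact Sum.inr_ne_inl h

theorem ncard_internalNodes_ladderProblem : (ladderProblem m l D).internalNodes.ncard = m := by
  have hinj : Function.Injective fun i : Fin m => (Sum.inl i.succ : Fin (m + 1) ⊕ Fin l) :=
    Sum.inl_injective.comp (Fin.succ_injective m)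
  have h : (Set.range fun i : Fin m => (Sum.inl i.succ : Fin (m + 1) ⊕ Fin l)).ncard = m := by
    rw [← Set.image_univ, Set.ncard_image_of_injective _ hinj, Set.ncard_univ, Nat.card_fin]
  rw [internalNodes_ladderProblem]
  exact h

theorem internalCount_fullPath_le (t : Fin l) :
    (ladderProblem m l D).internalCount (fullPath m l D t) ≤ if D t then m else 0 := by
  split_ifs with h
  · refine (Set.ncard_le_ncard (fun v hv => hv.1) (Set.toFinite _)).trans
      (ncard_internalNodes_ladderProblem m l D).le
  · have h0 : {v | v ∈ (ladderProblem m l D).internalNodes ∧ ∃ j, ∃ e ∈ fullPath m l D t j,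
        (ladderProblem m l D).tail e = v ∨ (ladderProblem m l D).head e = v} = ∅ := by
      rw [Set.eq_empty_iff_forall_notMem]
      rintro v ⟨hv, j, e, he, hev⟩
      rw [internalNodes_ladderProblem] at hv
      obtain ⟨i, rfl⟩ := hv
      have hr : rung D (t, j) = 0 := by simp [rung, h]
      rw [fullPath, hr] at he
      obtain rfl := List.mem_singleton.1 he
      rcases hev with hev | hev
      · have := Sum.inl_injective (hev : Sum.inl (rung D (t, j)) = Sum.inl i.succ)
        rw [hr] at this
        exact Fin.succ_ne_zero i this.symm
      · exact Sum.inr_ne_inl (hev : Sum.inr t = Sum.inl i.succ)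
    exact (congrArg Set.ncard h0).le.trans (by simp)

theorem ladderProblem_mem_internalFixed : ladderProblem m l D ∈ internalFixed m l :=
  ⟨ncard_internalNodes_ladderProblem m l D, card_sinks_ladderProblem m l D⟩

theorem ladderProblem_mem_pathBounded {n : ℕ} (hn : ∑ t, (if D t then m else 0) ≤ n) :
    ladderProblem m l D ∈ pathBounded n l := by
  refine ⟨card_sinks_ladderProblem m l D,
    -- Nodes of the chain are not sinks, so their empty families are mere placeholders.
    Sum.elim (fun _ _ => []) fun t => fullPath m l D t, fun t ht => ?_, ?_⟩
  · obtain ⟨t, -, rfl⟩ := Finset.mem_map.1 ht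
    exact ⟨isPath_fullPath m l D t, disjoint_fullPath m l D t⟩
  · refine le_trans ?_ hn
    change ∑ t ∈ Finset.univ.map Function.Embedding.inr, _ ≤ _
    rw [Finset.sum_map]
    exact Finset.sum_le_sum fun t _ => internalCount_fullPath_le m l D t

/-! ### The lower bound on the failure probability of ladders. -/

variable {m l D} {F : Type} [Field F]

/-- The kernels of the channels into the sink `t`. -/
noncomputable def sinkKernel (k : (ladderProblem m l D).Coeffs F) (t : Fin l) (j : Fin (m + 1)) :
    Fin (m + 1) → F :=
  (ladderProblem m l D).kernel k (Sum.inr (t, j))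

/-- The span of the kernels that enter the node `a` of the chain. -/
noncomputable def rungSpan (k : (ladderProblem m l D).Coeffs F) (a : Fin (m + 1)) :
    Submodule F (Fin (m + 1) → F) :=
  Submodule.span F (Set.range fun d : {d : (ladderProblem m l D).E ⊕ Fin (m + 1) //
    (ladderProblem m l D).entersAt d = (Sum.inl a : Fin (m + 1) ⊕ Fin l)} =>
      (ladderProblem m l D).extKernel k d.1)

theorem eq_of_entersAt_succ {i : Fin m} {d : (ladderProblem m l D).E ⊕ Fin (m + 1)}
    (hd : (ladderProblem m l D).entersAt d = (Sum.inl i.succ : Fin (m + 1) ⊕ Fin l)) :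
    ∃ p : {p : Fin (m + 1) × Fin (m + 1) // p.1 < p.2},
      d = Sum.inl (Sum.inl p) ∧ p.1.1 = i.castSucc := by
  rcases d with (p | p) | j
  · refine ⟨p, rfl, Fin.ext ?_⟩
    have h : (⟨p.1.1 + 1, by have := p.2; omega⟩ : Fin (m + 1)) = i.succ := Sum.inl_injective hd
    have := congrArg Fin.val h
    simpa using this
  · exact absurd hd fun h => Sum.inr_ne_inl (h : Sum.inr p.1 = Sum.inl i.succ)
  · exact absurd (Sum.inl_injective (hd : Sum.inl 0 = Sum.inl i.succ)) (Fin.succ_ne_zero i).symm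

theorem antitone_rungSpan (k : (ladderProblem m l D).Coeffs F) : Antitone (rungSpan k) := by
  rw [Fin.antitone_iff_succ_le]
  intro i
  rw [rungSpan, Submodule.span_le]
  rintro _ ⟨⟨d, hd⟩, rfl⟩
  obtain ⟨p, rfl, hp⟩ := eq_of_entersAt_succ hd
  have h : (ladderProblem m l D).kernel k (Sum.inl p) ∈ rungSpan k p.1.1 :=
    Problem.kernel_mem_incomingSpan k (Sum.inl p)
  rwa [hp] at h

/-- A node `a > 0` is entered only by the parallel channels with labels `a, …, m`; at the source the
ambient dimension is the bound. -/
theorem finrank_rungSpan_le (k : (ladderProblem m l D).Coeffs F) (a : Fin (m + 1)) :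
    Module.finrank F (rungSpan k a) ≤ m + 1 - a := by
  refine a.cases ?_ fun i => ?_
  · exact (Submodule.finrank_le _).trans (by simp)
  · have : Fintype {d : (ladderProblem m l D).E ⊕ Fin (m + 1) //
      (ladderProblem m l D).entersAt d = (Sum.inl i.succ : Fin (m + 1) ⊕ Fin l)} :=
        Fintype.ofFinite _
    refine (finrank_range_le_card _).trans ?_
    choose f hf hfi using fun d : {d : (ladderProblem m l D).E ⊕ Fin (m + 1) //
      (ladderProblem m l D).entersAt d = (Sum.inl i.succ : Fin (m + 1) ⊕ Fin l)} =>
        eq_of_entersAt_succ d.2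
    have hcard : Fintype.card (Finset.Ici i.succ) = m + 1 - (i.succ : Fin (m + 1)) :=
      (Fintype.card_coe _).trans (Fin.card_Ici _)
    rw [← hcard]
    refine Fintype.card_le_of_injective (fun d => ⟨(f d).1.2, ?_⟩) fun d d' h => ?_
    · have h1 := (f d).2
      rw [hfi d] at h1
      exact Finset.mem_Ici.2 (Fin.castSucc_lt_iff_succ_le.1 h1)
    · have h1 : (f d).1.2 = (f d').1.2 := congrArg Subtype.val h
      have h2 : f d = f d' := Subtype.ext (Prod.ext ((hfi d).trans (hfi d').symm) h1)
      exact Subtype.ext ((hf d).trans (h2 ▸ (hf d').symm))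

theorem sinkKernel_mem (k : (ladderProblem m l D).Coeffs F) (p : Fin l × Fin (m + 1)) :
    sinkKernel k p.1 p.2 ∈ rungSpan k (rung D p) :=
  Problem.kernel_mem_incomingSpan k (Sum.inr p)

/-- For a sink in `D` the later kernels come from farther rungs, whose spans are contained in that
of rung `p.2`. For other sinks the hypothesis forces `p.2 = 0`, and the ambient dimension suffices.
-/
theorem finrank_rungSpan_sup_le (k : (ladderProblem m l D).Coeffs F) {p : Fin l × Fin (m + 1)}
    (hp : rung D p = p.2) :
    Module.finrank F (rungSpan k p.2 ⊔ Submodule.span F (sinkKernel k p.1 '' Set.Ioi p.2) :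
      Submodule F (Fin (m + 1) → F)) ≤ m + 1 - p.2 := by
  obtain ⟨t, j⟩ := p
  by_cases hD : D t
  · have h1 : rungSpan k j ⊔ Submodule.span F (sinkKernel k t '' Set.Ioi j) = rungSpan k j := by
      rw [sup_eq_left, Submodule.span_le]
      rintro _ ⟨i, hi, rfl⟩
      have h2 := sinkKernel_mem k (t, i)
      rw [show rung D (t, i) = i by simp [rung, hD]] at h2
      exact antitone_rungSpan k (le_of_lt hi) h2
    simp only
    rw [h1]
    exact finrank_rungSpan_le k j
  · obtain rfl : (0 : Fin (m + 1)) = j := by simpa [rung, hD] using hp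
    exact (Submodule.finrank_le _).trans (by simp)

/-- The channels into `t` from the `j`-th on have linearly independent kernels. -/
def TailIndependent (p : Fin l × Fin (m + 1)) (k : (ladderProblem m l D).Coeffs F) : Prop :=
  LinearIndepOn F (sinkKernel k p.1) (Set.Ici p.2)

theorem isPast_ne (p : Fin l × Fin (m + 1)) :
    (ladderProblem m l D).IsPast {a | a ≠ Sum.inr p} (Sum.inr p) where
  closed a _ d hd := by
    rintro rfl
    rcases a with a | a
    · exact Sum.inr_ne_inl (hd : Sum.inr p.1 = Sum.inl a.1.1)
    · exact Sum.inr_ne_inl (hd : Sum.inr p.1 = Sum.inl (rung D a))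
  notMem h := h rfl
  feeds d hd := by
    rintro rfl
    exact Sum.inr_ne_inl (hd : Sum.inr p.1 = Sum.inl (rung D p))

theorem sinkKernel_eq {p : Fin l × Fin (m + 1)} {k k' : (ladderProblem m l D).Coeffs F}
    (h : (ladderProblem m l D).AgreeOff (Sum.inr p) k k') {t : Fin l} {j : Fin (m + 1)}
    (hne : (t, j) ≠ p) : sinkKernel k t j = sinkKernel k' t j :=
  (isPast_ne p).kernel_eq h (Sum.inr (t, j)) fun h => hne (Sum.inr_injective h)

variable [Finite F]

/-- If the kernels after `p.2` are independent, they span dimension `m - p.2`, while the span of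
rung `p.2` adds at most one to it. So channel `p` falls into their span with conditional probability
at least 1/q. As `p.2` is minimal, none of the events for `s` involves channel `p`. -/
theorem card_tailIndependent_insert_mul_le (s : Finset (Fin l × Fin (m + 1)))
    {p : Fin l × Fin (m + 1)} (hps : p ∉ s) (hmin : ∀ a ∈ s, p.2 ≤ a.2) (hp : rung D p = p.2) :
    (Nat.card {k : (ladderProblem m l D).Coeffs F // ∀ a ∈ insert p s, TailIndependent a k} : ℝ) ≤
      (1 - 1 / (Nat.card F : ℝ)) *
        Nat.card {k : (ladderProblem m l D).Coeffs F // ∀ a ∈ s, TailIndependent a k} := by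
  have : Fintype F := Fintype.ofFinite F
  let W : (ladderProblem m l D).Coeffs F → Submodule F (Fin (m + 1) → F) := fun k =>
    Submodule.span F (sinkKernel k p.1 '' Set.Ioi p.2)
  let Q : (ladderProblem m l D).Coeffs F → Prop := fun k =>
    (∀ a ∈ s, TailIndependent a k) ∧ LinearIndepOn F (sinkKernel k p.1) (Set.Ioi p.2)
  have hoff : ∀ k k' : (ladderProblem m l D).Coeffs F,
      (ladderProblem m l D).AgreeOff (Sum.inr p) k k' →
      Set.EqOn (sinkKernel k p.1) (sinkKernel k' p.1) (Set.Ioi p.2) := fun k k' h j hj =>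
    sinkKernel_eq h fun h' => (ne_of_gt hj : j ≠ p.2) (congrArg Prod.snd h')
  have hW : ∀ k k', (ladderProblem m l D).AgreeOff (Sum.inr p) k k' → W k = W k' := by
    intro k k' h
    simp only [W]
    rw [(hoff k k' h).image_eq]
  have hQ : ∀ k k', (ladderProblem m l D).AgreeOff (Sum.inr p) k k' → Q k → Q k' := by
    rintro k k' h ⟨h1, h2⟩
    refine ⟨fun a ha => (h1 a ha).congr fun j hj => sinkKernel_eq h ?_, h2.congr (hoff k k' h)⟩
    -- If an event for `a` involved channel `p`, minimality would force `p = a`, contrary to `p ∉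
    -- s`.
    rintro rfl
    have hle : (a.1, j).2 ≤ a.2 := hmin a ha
    obtain rfl : j = a.2 := le_antisymm hle hj
    exact hps ha
  have hc : ∀ k, Q k → Module.finrank F ((ladderProblem m l D).incomingSpan k (Sum.inr p) ⊔ W k :
      Submodule F (Fin (m + 1) → F)) ≤ Module.finrank F (W k) + 1 := by
    rintro k ⟨-, h2⟩
    have h3 : Module.finrank F (W k) = m - p.2 := by
      have := finrank_span_eq_card h2
      rw [← Set.image_eq_range] at this
      simpa [W] using this
    have h4 : (ladderProblem m l D).incomingSpan k (Sum.inr p) = rungSpan k (rung D p) := rfl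
    rw [h4, hp, h3]
    exact (finrank_rungSpan_sup_le k hp).trans (by omega)
  have h1 := Problem.card_le_card_kernel_mem_mul (isPast_ne p) hQ hW hc
  have h2 : Nat.card {k : (ladderProblem m l D).Coeffs F //
      ∀ a ∈ insert p s, TailIndependent a k} + Nat.card {k // Q k ∧ sinkKernel k p.1 p.2 ∈ W k} ≤
      Nat.card {k // Q k} := by
    simp only [Nat.card_eq_fintype_card, Fintype.card_subtype]
    rw [← Finset.card_union_of_disjoint]
    · refine Finset.card_le_card fun k hk => ?_
      simp only [Finset.mem_union, Finset.mem_filter, Finset.mem_univ, true_and] at hk ⊢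
      rcases hk with hk | hk
      · exact ⟨fun a ha => hk a (Finset.mem_insert_of_mem ha),
          (hk p (Finset.mem_insert_self _ _)).mono Set.Ioi_subset_Ici_self⟩
      · exact hk.1
    · rw [Finset.disjoint_left]
      intro k hk hk'
      simp only [Finset.mem_filter, Finset.mem_univ, true_and] at hk hk'
      have h3 : LinearIndepOn F (sinkKernel k p.1) (Set.Ici p.2) :=
        hk p (Finset.mem_insert_self _ _)
      rw [← Set.Ioi_insert, linearIndepOn_insert (by simp)] at h3
      exact h3.2 hk'.2
  have h3 : Nat.card {k // Q k} ≤
      Nat.card {k : (ladderProblem m l D).Coeffs F // ∀ a ∈ s, TailIndependent a k} :=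
    Nat.card_le_card_of_injective (fun k => ⟨k.1, k.2.1⟩)
      fun a b h => Subtype.ext (Subtype.mk_eq_mk.1 h)
  have hq : (1 : ℝ) ≤ Nat.card F := by exact_mod_cast Nat.card_pos (α := F)
  have hq0 : (0 : ℝ) < Nat.card F := by linarith
  have h1' : (Nat.card {k // Q k} : ℝ) ≤
      Nat.card {k // Q k ∧ sinkKernel k p.1 p.2 ∈ W k} * Nat.card F := by exact_mod_cast h1
  have h2' : (Nat.card {k : (ladderProblem m l D).Coeffs F //
      ∀ a ∈ insert p s, TailIndependent a k} : ℝ) +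
        Nat.card {k // Q k ∧ sinkKernel k p.1 p.2 ∈ W k} ≤ Nat.card {k // Q k} := by
    exact_mod_cast h2
  rw [← div_le_iff₀ hq0] at h1'
  calc _ ≤ (Nat.card {k // Q k} : ℝ) - Nat.card {k // Q k} / Nat.card F := by linarith
    _ = (1 - 1 / (Nat.card F : ℝ)) * Nat.card {k // Q k} := by ring
    _ ≤ _ := mul_le_mul_of_nonneg_left (by exact_mod_cast h3)
      (sub_nonneg.2 ((div_le_one hq0).2 hq))

theorem card_tailIndependent_le (s : Finset (Fin l × Fin (m + 1)))
    (hs : ∀ p ∈ s, rung D p = p.2) :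
    (Nat.card {k : (ladderProblem m l D).Coeffs F // ∀ a ∈ s, TailIndependent a k} : ℝ) ≤
      (1 - 1 / (Nat.card F : ℝ)) ^ s.card * Nat.card ((ladderProblem m l D).Coeffs F) := by
  -- The tests are added in order of decreasing index, over all sinks at once.
  induction s using Finset.induction_on_min_value (fun p : Fin l × Fin (m + 1) => p.2) with
  | empty => simp
  | insert p s hps hmin ih =>
    have hq : (1 : ℝ) ≤ Nat.card F := by exact_mod_cast Nat.card_pos (α := F)
    rw [Finset.card_insert_of_notMem hps, pow_succ', mul_assoc]
    refine (card_tailIndependent_insert_mul_le s hps hmin (hs p (by simp))).trans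
      (mul_le_mul_of_nonneg_left (ih fun a ha => hs a (Finset.mem_insert_of_mem ha)) ?_)
    exact sub_nonneg.2 ((div_le_one (by linarith)).2 hq)

theorem tailIndependent_of_rank (k : (ladderProblem m l D).Coeffs F) (p : Fin l × Fin (m + 1))
    (h : ¬ ((ladderProblem m l D).decodingMatrix k
      (Sum.inr p.1 : Fin (m + 1) ⊕ Fin l)).rank < m + 1) : TailIndependent p k := by
  have h1 : LinearIndependent F (sinkKernel k p.1) := by
    rw [linearIndependent_iff_card_le_finrank_span, Fintype.card_fin]
    refine (not_lt.1 h).trans ((Problem.rank_decodingMatrix (N := ladderProblem m l D) k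
      (Sum.inr p.1 : Fin (m + 1) ⊕ Fin l)).le.trans
        (Submodule.finrank_mono (Submodule.span_mono ?_)))
    rintro _ ⟨⟨e, he⟩, rfl⟩
    rcases e with e | e
    · exact absurd he Sum.inl_ne_inr
    · have he' : e.1 = p.1 := Sum.inr_injective he
      exact ⟨e.2, congrArg (fun t => sinkKernel k t e.2) he'.symm⟩
  exact (linearIndepOn_univ_iff.2 h1).mono (Set.subset_univ _)

theorem failureProb_ladderProblem_ge (s : Finset (Fin l × Fin (m + 1)))
    (hs : ∀ p ∈ s, rung D p = p.2) :
    1 - (1 - 1 / (Nat.card F : ℝ)) ^ s.card ≤ (ladderProblem m l D).failureProb F := by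
  have : Fintype F := Fintype.ofFinite F
  have hK : (0 : ℝ) < Nat.card ((ladderProblem m l D).Coeffs F) := by
    exact_mod_cast Nat.card_pos
  have h1 : Nat.card ((ladderProblem m l D).Coeffs F) ≤
      Nat.card {k : (ladderProblem m l D).Coeffs F // ∃ t ∈ (ladderProblem m l D).T,
        ((ladderProblem m l D).decodingMatrix k t).rank < (ladderProblem m l D).w} +
      Nat.card {k : (ladderProblem m l D).Coeffs F // ∀ a ∈ s, TailIndependent a k} := by
    simp only [Nat.card_eq_fintype_card, Fintype.card_subtype]
    rw [← Finset.card_univ]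
    refine (Finset.card_le_card fun k _ => ?_).trans (Finset.card_union_le _ _)
    simp only [Finset.mem_union, Finset.mem_filter, Finset.mem_univ, true_and]
    by_contra! hcon
    obtain ⟨hall, a, ha, hna⟩ := hcon
    refine hna (tailIndependent_of_rank k a (not_lt.2 (hall _ ?_)))
    exact Finset.mem_map.2 ⟨a.1, Finset.mem_univ _, rfl⟩
  have h2 : (Nat.card ((ladderProblem m l D).Coeffs F) : ℝ) ≤
      Nat.card {k : (ladderProblem m l D).Coeffs F // ∃ t ∈ (ladderProblem m l D).T,
        ((ladderProblem m l D).decodingMatrix k t).rank < (ladderProblem m l D).w} +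
      Nat.card {k : (ladderProblem m l D).Coeffs F // ∀ a ∈ s, TailIndependent a k} := by
    exact_mod_cast h1
  have h3 := card_tailIndependent_le (F := F) s hs
  rw [Problem.failureProb, le_div_iff₀ hK]
  linarith

end Ladder

theorem exists_sum_ite_eq {l : ℕ} (hl : 1 ≤ l) (n : ℕ) :
    ∃ D : Fin l → Prop, ∑ t, (if D t then n else 0) = n :=
  ⟨fun t => t = ⟨0, hl⟩, (Finset.sum_eq_single (⟨0, hl⟩ : Fin l) (fun _ _ ht => if_neg ht)
    fun h => absurd (Finset.mem_univ _) h).trans (if_pos rfl)⟩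

theorem le_Omega_ladderProblem (m l : ℕ) (D : Fin l → Prop) :
    (((∑ t, (1 + if D t then m else 0) : ℕ) : ℝ) : EReal) ≤ (ladderProblem m l D).Omega := by
  -- The tests that count: all `m + 1` channels of a sink in `D`, but only channel 0 of any other
  -- sink.
  let s : Finset (Fin l × Fin (m + 1)) := Finset.univ.filter fun p => rung D p = p.2
  have hs : s.card = ∑ t, (1 + if D t then m else 0) := by
    rw [Finset.card_filter, Fintype.sum_prod_type]
    refine Finset.sum_congr rfl fun t _ => ?_
    by_cases h : D t
    · simp [rung, h, add_comm]
    · simp [rung, h]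
  rw [← hs]
  exact Problem.le_Omega _ fun F =>
    failureProb_ladderProblem_ge s fun p hp => (Finset.mem_filter.1 hp).2

end RLNC

theorem theorem6 (l : ℕ) (hl : 1 ≤ l) :
    (∀ n : ℕ, IsGreatest (RLNC.Problem.Omega '' RLNC.pathBounded n l) (((l + n : ℕ) : ℝ) : EReal)) ∧
    (∀ m : ℕ, IsGreatest (RLNC.Problem.Omega '' RLNC.internalFixed m l)
      (((l * (1 + m) : ℕ) : ℝ) : EReal)) := by
  refine ⟨fun n => ⟨?_, ?_⟩, fun m => ⟨?_, ?_⟩⟩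
  -- A single sink hangs on a chain with `n` internal nodes, the others directly on the source; this
  -- is where `1 ≤ l` enters.
  · obtain ⟨D, hsum⟩ := RLNC.exists_sum_ite_eq hl n
    have hmem : RLNC.ladderProblem n l D ∈ RLNC.pathBounded n l :=
      RLNC.ladderProblem_mem_pathBounded n l D hsum.le
    refine ⟨_, hmem, (RLNC.Problem.Omega_le_of_mem_pathBounded hmem).antisymm ?_⟩
    convert RLNC.le_Omega_ladderProblem n l D using 3
    rw [Finset.sum_add_distrib, hsum]
    simp
  · rintro _ ⟨N, hN, rfl⟩
    exact RLNC.Problem.Omega_le_of_mem_pathBounded hN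
  · have hmem := RLNC.ladderProblem_mem_internalFixed m l fun _ => True
    refine ⟨_, hmem, (RLNC.Problem.Omega_le_of_mem_internalFixed hmem).antisymm ?_⟩
    convert RLNC.le_Omega_ladderProblem m l fun _ => True using 3
    simp
  · rintro _ ⟨N, hN, rfl⟩
    exact RLNC.Problem.Omega_le_of_mem_internalFixed hN
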